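/- **Setting.** Let $\mathbb R^{1,1}$ be $\mathbb R^2$ with coordinates $(x^0,x^1)$ and metric $g=-(dx^0)^2+(dx^1)^2$. A causal curve is a $C^1$ curve $\gamma:[0,T]\to\mathbb R^{1,1}$ with $\dot\gamma_0>0$ and $g(\dot\gamma,\dot\gamma)\le 0$ throughout (one-point curves, $T=0$, are allowed), its proper time is $l(\gamma)=\int_0^T\sqrt{-g(\dot\gamma,\dot\gamma)}\,dt$, and $p\preceq q$ means that there is a causal curve from $p$ to $q$. Let $\mathcal C_{\mathcal M}$ be the set of smooth real functions on $\mathbb R^{1,1}$ that are bounded together with all their derivatives and non-decreasing along causal curves, and let $\widetilde{\mathcal A}$ be the algebra of functions $\mathbf a:\mathbb R^{1,1}\to M_2(\mathbb C)$ whose diagonal entries lie in $\mathrm{span}_{\mathbb C}(\mathcal C_{\mathcal M})$ and whose off-diagonal entries are Schwartz functions. On $\mathcal H=L^2(\mathbb R^{1,1})\otimes\mathbb C^2\otimes\mathbb C^2$ put, for $d_1,d_2\in\mathbb R$, $$D=-i\gamma^\mu\partial_\mu\otimes 1+\gamma^0\gamma^1\otimes\mathrm{diag}(d_1,d_2),\qquad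 \mathcal J=i\gamma^0\otimes 1,\qquad \gamma^0=\begin{pmatrix}0&i\\ i&0\end{pmatrix},\quad \gamma^1=\begin{pmatrix}0&-i\\ i&0\end{pmatrix},$$ and let $\mathbf a\in\widetilde{\mathcal A}$ act by $1\otimes\mathbf a(x)$. Let $\mathcal C$ be the set of Hermitian $\mathbf a\in\widetilde{\mathcal A}$ with $\langle\phi,\mathcal J[D,\mathbf a]\phi\rangle\le 0$ for all $\phi\in\mathcal H$, where $[D,\mathbf a]$ denotes the bounded extension of the commutator. For states $\omega,\eta$ of $\widetilde{\mathcal A}$ write $\omega\preceq\eta$ if $\omega(\mathbf a)\le\eta(\mathbf a)$ for all $\mathbf a\in\mathcal C$. For $p\in\mathbb R^{1,1}$ and a density matrix $\rho\in M_2(\mathbb C)$ let $\omega_{p,\rho}(\mathbf a)=\mathrm{Tr}(\rho\,\mathbf a(p))$. **Theorem.** (1) Let $p,q\in\mathbb R^{1,1}$ and let $\rho=\tfrac12(1+\vec r\cdot\vec\sigma)$, $\sigma=\tfrac12(1+\vec s\cdot\vec\sigma)$ be density matrices with Bloch vectors $\vec r,\vec s$ in the closed unit ball of $\mathbb R^3$,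 where $\vec\sigma$ is the vector of Pauli matrices. Write $r_x+ir_y=re^{i\theta_r}$ and $s_x+is_y=se^{i\theta_s}$ with $r,s\ge 0$ and $\theta_r,\theta_s\in\mathbb R$. Then $\omega_{p,\rho}\preceq\omega_{q,\sigma}$ if and only if * $p\preceq q$ in $\mathbb R^{1,1}$; * $r_z=s_z=:z$; * there is a causal curve $\gamma$ from $p$ to $q$ with $$l(\gamma)\,|d_1-d_2|\ \ge\ \sup_{\theta\in\mathbb R}\left|\arccos\!\Big(\tfrac{s}{\sqrt{1-z^2}}\cos(\theta_s+\theta)\Big)-\arccos\!\Big(\tfrac{r}{\sqrt{1-z^2}}\cos(\theta_r+\theta)\Big)\right|,$$ where for $z=\pm1$ (so that $r=s=0$) both quotients are read as $0$. (2) Consequently, paths through mixed states do not shorten the proper time needed: let $\gamma:[0,T]\to\mathbb R^{1,1}$ be a causal curve and let $t\mapsto\rho_t$ be a continuous family of density matrices, $t\in[0,T]$, such that $\omega_{\gamma(t),\rho_t}\preceq\omega_{\gamma(t'),\rho_{t'}}$ whenever $t\le t'$. If $\rho_0$ and $\rho_T$ are pure (of the form $\xi\xi^*$), then along the same curve $\gamma$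 there is a continuous family of pure density matrices $\rho'_t$ with $\rho'_0=\rho_0$, $\rho'_T=\rho_T$ and $\omega_{\gamma(t),\rho'_t}\preceq\omega_{\gamma(t'),\rho'_{t'}}$ whenever $t\le t'$. -/

import Mathlib

open scoped ContDiff ComplexOrder Kronecker Matrix SchwartzMap
open MeasureTheory

noncomputable section

namespace AlmostCommutative

/-! ### Two-dimensional Minkowski space-time -/

/-- The space `ℝ^{1,1}`; a point is `(x⁰, x¹)` with `x⁰` the time coordinate. -/
abbrev Minkowski : Type := ℝ × ℝ

/-- The flat metric of signature `(-,+)`. -/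
def metric (v w : Minkowski) : ℝ := -(v.1 * w.1) + v.2 * w.2

/-- Nonzero future directed causal (timelike or null) vectors. -/
def IsFutureCausal (v : Minkowski) : Prop := metric v v ≤ 0 ∧ 0 < v.1

/-- The velocity of a curve defined on `[0,T]` (one-sided at the end points). -/
def velocity (γ : ℝ → Minkowski) (T t : ℝ) : Minkowski := derivWithin γ (Set.Icc 0 T) t

/-- Future directed causal `C¹` curves `γ : [0,T] → ℝ^{1,1}`. The case `T = 0` is the
one-point curve, which makes the causal relation reflexive, as is customary. -/
def IsCausalCurve (γ : ℝ → Minkowski) (T : ℝ) : Prop :=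
  0 ≤ T ∧ ContDiffOn ℝ 1 γ (Set.Icc 0 T) ∧
    (0 < T → ∀ t ∈ Set.Icc 0 T, IsFutureCausal (velocity γ T t))

/-- The proper time `l(γ)` of a causal curve. -/
def properTime (γ : ℝ → Minkowski) (T : ℝ) : ℝ :=
  ∫ t in (0 : ℝ)..T, √(-metric (velocity γ T t) (velocity γ T t))

/-- `p ⪯ q` in `ℝ^{1,1}`. -/
def Precedes (p q : Minkowski) : Prop :=
  ∃ (γ : ℝ → Minkowski) (T : ℝ), IsCausalCurve γ T ∧ γ 0 = p ∧ γ T = q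

/-- Causal functions: real functions that are non-decreasing along future directed causal
curves. -/
def IsCausalFunction (f : Minkowski → ℝ) : Prop :=
  ∀ (γ : ℝ → Minkowski) (T : ℝ), IsCausalCurve γ T → MonotoneOn (f ∘ γ) (Set.Icc 0 T)

/-! ### The algebra -/

/-- `C_M`: smooth causal functions that are bounded together with all their derivatives (the
case `n = 0` is the boundedness of the function), seen as complex functions. -/
def causalFunctions : Set (Minkowski → ℂ) :=
  {f | ∃ g : Minkowski → ℝ, ContDiff ℝ ∞ g ∧
    (∀ n : ℕ, ∃ C : ℝ, ∀ x, ‖iteratedFDeriv ℝ n g x‖ ≤ C) ∧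
    IsCausalFunction g ∧ ∀ x, f x = (g x : ℂ)}

/-- The unitisation of the algebra of Schwartz functions: the complex span of `C_M`. -/
def scalarAlgebra : Submodule ℂ (Minkowski → ℂ) := Submodule.span ℂ causalFunctions

/-- The complex `2 × 2` matrices. -/
abbrev Mat2 : Type := Matrix (Fin 2) (Fin 2) ℂ

/-- The unitisation of `S(ℝ^{1,1}) ⊗ M₂(ℂ)`: matrix functions with diagonal entries in the
span of the causal functions and with Schwartz off-diagonal entries. -/
def algebra : Submodule ℂ (Minkowski → Mat2) where
  carrier := {a | (∀ i, (fun x => a x i i) ∈ scalarAlgebra) ∧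
    ∀ i j, i ≠ j → ∃ f : 𝓢(Minkowski, ℂ), ∀ x, a x i j = f x}
  zero_mem' := ⟨fun _ => scalarAlgebra.zero_mem, fun _ _ _ => ⟨0, fun _ => rfl⟩⟩
  add_mem' := by
    rintro a b ⟨ha, ha'⟩ ⟨hb, hb'⟩
    refine ⟨fun i => scalarAlgebra.add_mem (ha i) (hb i), fun i j hij => ?_⟩
    obtain ⟨f, hf⟩ := ha' i j hij
    obtain ⟨g, hg⟩ := hb' i j hij
    exact ⟨f + g, fun x => by simp [hf, hg]⟩
  smul_mem' := by
    rintro c a ⟨ha, ha'⟩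
    refine ⟨fun i => scalarAlgebra.smul_mem c (ha i), fun i j hij => ?_⟩
    obtain ⟨f, hf⟩ := ha' i j hij
    exact ⟨c • f, fun x => by simp [hf]⟩

/-! ### The Hilbert space, the Dirac operator and the fundamental symmetry -/

/-- `ℂ² ⊗ ℂ²`; the first index is the spinor index, the second one is internal. -/
abbrev Spinor : Type := EuclideanSpace ℂ (Fin 2 × Fin 2)

/-- `L²(ℝ^{1,1}) ⊗ ℂ² ⊗ ℂ²`. -/
abbrev Hilbert : Type := Lp Spinor 2 (volume : Measure Minkowski)

/-- The operator on `ℂ² ⊗ ℂ²` given by a matrix. -/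
def op (A : Matrix (Fin 2 × Fin 2) (Fin 2 × Fin 2) ℂ) : Spinor →L[ℂ] Spinor :=
  Matrix.toEuclideanCLM (n := Fin 2 × Fin 2) (𝕜 := ℂ) A

def gamma0 : Mat2 := !![0, Complex.I; Complex.I, 0]

def gamma1 : Mat2 := !![0, -Complex.I; Complex.I, 0]

/-- The finite-part Dirac operator `diag(d₁, d₂)`. -/
def finiteDirac (d₁ d₂ : ℝ) : Mat2 := Matrix.diagonal ![(d₁ : ℂ), (d₂ : ℂ)]

/-- The Dirac operator `-i γ^μ ∂_μ ⊗ 1 + γ⁰γ¹ ⊗ diag(d₁, d₂)`, on differentiable spinors. -/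
def dirac (d₁ d₂ : ℝ) (φ : Minkowski → Spinor) (x : Minkowski) : Spinor :=
  (-Complex.I) • (op (gamma0 ⊗ₖ (1 : Mat2)) (fderiv ℝ φ x (1, 0)) +
    op (gamma1 ⊗ₖ (1 : Mat2)) (fderiv ℝ φ x (0, 1))) +
  op ((gamma0 * gamma1) ⊗ₖ finiteDirac d₁ d₂) (φ x)

/-- The representation of matrix functions on spinors. -/
def rep (a : Minkowski → Mat2) (φ : Minkowski → Spinor) (x : Minkowski) : Spinor :=
  op ((1 : Mat2) ⊗ₖ a x) (φ x)

/-- The fundamental symmetry `J = i γ⁰ ⊗ 1` on the Hilbert space. -/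
def fundamentalSymmetry : Hilbert →L[ℂ] Hilbert :=
  (op ((Complex.I • gamma0) ⊗ₖ (1 : Mat2))).compLpL 2 volume

/-- `B` is the bounded extension to the Hilbert space of the commutator `[D, a]`, which is
defined on the dense subspace of smooth spinors with compact support. -/
def ExtendsCommutator (d₁ d₂ : ℝ) (a : Minkowski → Mat2) (B : Hilbert →L[ℂ] Hilbert) : Prop :=
  ∀ φ : Minkowski → Spinor, ContDiff ℝ ∞ φ → HasCompactSupport φ →
    ∀ ψ : Hilbert, ψ =ᵐ[volume] φ →
      B ψ =ᵐ[volume] fun x => dirac d₁ d₂ (rep a φ) x - rep a (dirac d₁ d₂ φ) x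

/-- The causal cone: the Hermitian elements `a` of the algebra such that
`⟨φ, J [D, a] φ⟩ ≤ 0` for all `φ` in the Hilbert space. -/
def causalCone (d₁ d₂ : ℝ) : Set algebra :=
  {a | (∀ x, (a.1 x).IsHermitian) ∧
    ∃ B : Hilbert →L[ℂ] Hilbert, ExtendsCommutator d₁ d₂ a.1 B ∧
      ∀ φ : Hilbert, inner ℂ φ (fundamentalSymmetry (B φ)) ≤ 0}

/-! ### States -/

theorem one_mem_algebra : (1 : Minkowski → Mat2) ∈ algebra := by
  refine ⟨fun i => ?_, fun i j hij => ⟨0, fun x => by simp [hij]⟩⟩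
  refine Submodule.subset_span ⟨fun _ => 1, contDiff_const, fun n => ?_, ?_, fun x => by simp⟩
  · rcases Nat.eq_zero_or_pos n with rfl | hn
    · exact ⟨1, fun x => by simp⟩
    · exact ⟨0, fun x => by
        rw [iteratedFDeriv_const_of_ne (Nat.pos_iff_ne_zero.mp hn)]; simp⟩
  · intro γ T _ s _ t _ _
    exact le_rfl

/-- States: positive unital linear functionals that are continuous for the `C*`-norm
`sup_x ‖a(x)‖`; these are the restrictions of the states of the `C*`-completion. -/
structure State where
  toFun : algebra →ₗ[ℂ] ℂ
  unital : toFun ⟨1, one_mem_algebra⟩ = 1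
  positive : ∀ a b : algebra, (∀ x, b.1 x = (a.1 x)ᴴ * a.1 x) → 0 ≤ toFun b
  bounded : ∃ C : ℝ, ∀ (a : algebra) (K : ℝ),
    (∀ x, ‖Matrix.toEuclideanCLM (n := Fin 2) (𝕜 := ℂ) (a.1 x)‖ ≤ K) → ‖toFun a‖ ≤ C * K

/-- The causal relation between states. The value of a state on a Hermitian element is real. -/
def State.Precedes (d₁ d₂ : ℝ) (χ η : State) : Prop :=
  ∀ a ∈ causalCone d₁ d₂, (χ.toFun a).re ≤ (η.toFun a).re

/-- Density matrices, that is, the states of `M₂(ℂ)`. -/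
abbrev DensityMatrix : Type := {ρ : Mat2 // ρ.PosSemidef ∧ ρ.trace = 1}

/-- Pure density matrices `ξ ξ*`. -/
def IsPure (ρ : DensityMatrix) : Prop :=
  ∃ ξ : Fin 2 → ℂ, ρ.1 = Matrix.vecMulVec ξ (star ξ)

/-- The state `ω_{p,ρ}(a) = Tr(ρ a(p))`. -/
def productState (p : Minkowski) (ρ : DensityMatrix) : State where
  toFun :=
    { toFun := fun a => (ρ.1 * a.1 p).trace
      map_add' := fun a b => by simp [Matrix.mul_add]
      map_smul' := fun c a => by simp }
  unital := by simpa using ρ.2.2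
  positive := by
    intro a b hab
    have h := (ρ.2.1.mul_mul_conjTranspose_same (a.1 p)).trace_nonneg
    simp only [LinearMap.coe_mk, AddHom.coe_mk, hab]
    rwa [← Matrix.mul_assoc, Matrix.trace_mul_comm, ← Matrix.mul_assoc]
  bounded := by
    refine ⟨∑ i, ∑ j, ‖ρ.1 i j‖, fun a K hK => ?_⟩
    have entry : ∀ i j, ‖a.1 p i j‖ ≤ K := by
      intro i j
      have h1 := (Matrix.toEuclideanCLM (n := Fin 2) (𝕜 := ℂ) (a.1 p)).le_opNorm
        (EuclideanSpace.single j 1)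
      have h2 := PiLp.norm_apply_le
        (Matrix.toEuclideanCLM (n := Fin 2) (𝕜 := ℂ) (a.1 p) (EuclideanSpace.single j 1)) i
      have h3 : Matrix.toEuclideanCLM (n := Fin 2) (𝕜 := ℂ) (a.1 p)
          (EuclideanSpace.single j 1) i = a.1 p i j := by
        simp [Matrix.ofLp_toEuclideanCLM]
      rw [h3] at h2
      simp only [PiLp.norm_single, norm_one, mul_one] at h1
      exact h2.trans (h1.trans (hK p))
    simp only [LinearMap.coe_mk, AddHom.coe_mk, Matrix.trace, Matrix.diag, Matrix.mul_apply]
    rw [Finset.sum_mul]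
    refine (norm_sum_le _ _).trans (Finset.sum_le_sum fun i _ => ?_)
    rw [Finset.sum_mul]
    refine (norm_sum_le _ _).trans (Finset.sum_le_sum fun j _ => ?_)
    rw [norm_mul]
    exact mul_le_mul_of_nonneg_left (entry j i) (norm_nonneg _)

/-- The matrix `½ (1 + r_x σ_x + r_y σ_y + r_z σ_z)`, with the Pauli matrices written out. -/
def blochMatrix (r : EuclideanSpace ℝ (Fin 3)) : Mat2 :=
  (1 / 2 : ℂ) • ((1 : Mat2) + (r 0 : ℂ) • !![0, 1; 1, 0]
    + (r 1 : ℂ) • !![0, -Complex.I; Complex.I, 0] + (r 2 : ℂ) • !![1, 0; 0, -1])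

/-- A causal path of states `t ↦ ω_{γ(t),ρ(t)}`, for `t ∈ [0,T]`: a causal curve together with a
continuous family of density matrices such that earlier states precede later ones. -/
def IsCausalPath (d₁ d₂ : ℝ) (γ : ℝ → Minkowski) (T : ℝ) (ρ : ℝ → DensityMatrix) : Prop :=
  IsCausalCurve γ T ∧ ContinuousOn ρ (Set.Icc 0 T) ∧
    ∀ t ∈ Set.Icc 0 T, ∀ t' ∈ Set.Icc 0 T, t ≤ t' →
      (productState (γ t) (ρ t)).Precedes d₁ d₂ (productState (γ t') (ρ t'))

end AlmostCommutative

end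

open AlmostCommutative

/-!
The form `⟨φ, J [D, a] φ⟩` is multiplication by a matrix symbol, and it decouples into two
light-cone components; it is nonpositive exactly when, in every pure state, the growth of `a` along
a causal vector of length `l` is at least `l |d₁ - d₂|` times its rate of change under rotation of
the azimuth of the Bloch vector. Integrating this along a causal curve shows that the state may
rotate by any angle up to `l(γ) |d₁ - d₂|`. A state inside the Bloch ball is compared with the two
pure states having the same projection onto a given axis, which gives the arccosine condition.

For the converse, the test functions have diagonal part `A` and off-diagonal part `B`. Constant
multiples of diagonal causal functions force equal heights and `p ⪯ q`. With `A = cot θ` and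
`B = 1 / sin θ`, for an angle `θ` which decreases at rate `|d₁ - d₂|` in the time coordinate of a
boosted frame, the causality condition is an equality, and `A - x B = (cos θ - x) / sin θ` is
nonnegative exactly as long as `θ ≤ arccos x`; smoothing and cutting off these profiles yields the
bound on the arccosines. For a path of mixed states the bound is infinitesimal, so that the proper
time of the path itself, and not only of the geodesic joining its ends, suffices for a rotation of
the azimuth at constant rate from the first pure state to the last.
-/

open scoped ContDiff ComplexOrder Kronecker Matrix SchwartzMap
open MeasureTheory Topology

noncomputable section

namespace AlmostCommutative

/-! ### Regularity of the elements of the algebra -/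

theorem scalarAlgebra_contDiff {f : Minkowski → ℂ} (hf : f ∈ scalarAlgebra) :
    ContDiff ℝ ∞ f := by
  refine Submodule.span_induction (p := fun f _ => ContDiff ℝ ∞ f) ?_ contDiff_const
    (fun f g _ _ hf hg => hf.add hg) (fun c f _ hf => hf.const_smul c) hf
  rintro f ⟨g, hg, -, -, hfg⟩
  rw [funext hfg]
  exact Complex.ofRealCLM.contDiff.comp hg

theorem causalFunctions_bounded {f : Minkowski → ℂ} (hf : f ∈ causalFunctions) :
    ∃ C : ℝ, ∀ x, ‖f x‖ ≤ C ∧ ‖fderiv ℝ f x‖ ≤ C := by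
  obtain ⟨g, hg, hbound, -, hfg⟩ := hf
  obtain ⟨C₀, h₀⟩ := hbound 0
  obtain ⟨C₁, h₁⟩ := hbound 1
  simp only [norm_iteratedFDeriv_zero, norm_iteratedFDeriv_one] at h₀ h₁
  refine ⟨max C₀ C₁, fun x => ⟨?_, ?_⟩⟩
  · rw [hfg, Complex.norm_real]
    exact (h₀ x).trans (le_max_left _ _)
  · have hderiv : HasFDerivAt f (Complex.ofRealCLM.comp (fderiv ℝ g x)) x := by
      rw [funext hfg]
      exact Complex.ofRealCLM.hasFDerivAt.comp x (hg.differentiable (by simp) x).hasFDerivAt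
    calc ‖fderiv ℝ f x‖ ≤ ‖Complex.ofRealCLM‖ * ‖fderiv ℝ g x‖ :=
          hderiv.fderiv ▸ ContinuousLinearMap.opNorm_comp_le _ _
      _ = ‖fderiv ℝ g x‖ := by rw [Complex.ofRealCLM_norm, one_mul]
      _ ≤ max C₀ C₁ := (h₁ x).trans (le_max_right _ _)

theorem scalarAlgebra_bounded {f : Minkowski → ℂ} (hf : f ∈ scalarAlgebra) :
    ∃ C : ℝ, ∀ x, ‖f x‖ ≤ C ∧ ‖fderiv ℝ f x‖ ≤ C := by
  refine Submodule.span_induction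
    (p := fun f _ => ∃ C : ℝ, ∀ x, ‖f x‖ ≤ C ∧ ‖fderiv ℝ f x‖ ≤ C)
    (fun _ => causalFunctions_bounded) ⟨0, by simp⟩ ?_ ?_ hf
  · rintro f g hf hg ⟨C, hC⟩ ⟨C', hC'⟩
    refine ⟨C + C', fun x => ⟨norm_add_le_of_le (hC x).1 (hC' x).1, ?_⟩⟩
    rw [fderiv_add ((scalarAlgebra_contDiff hf).differentiable (by simp) x)
      ((scalarAlgebra_contDiff hg).differentiable (by simp) x)]
    exact norm_add_le_of_le (hC x).2 (hC' x).2
  · rintro c f hf ⟨C, hC⟩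
    refine ⟨‖c‖ * C, fun x => ⟨?_, ?_⟩⟩
    · rw [Pi.smul_apply, norm_smul]
      exact mul_le_mul_of_nonneg_left (hC x).1 (norm_nonneg _)
    · rw [fderiv_const_smul ((scalarAlgebra_contDiff hf).differentiable (by simp) x), norm_smul]
      exact mul_le_mul_of_nonneg_left (hC x).2 (norm_nonneg _)

theorem schwartzMap_bounded (f : 𝓢(Minkowski, ℂ)) :
    ∃ C : ℝ, ∀ x, ‖f x‖ ≤ C ∧ ‖fderiv ℝ f x‖ ≤ C := by
  obtain ⟨C₀, -, h₀⟩ := f.decay 0 0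
  obtain ⟨C₁, -, h₁⟩ := f.decay 0 1
  simp only [pow_zero, one_mul, norm_iteratedFDeriv_zero, norm_iteratedFDeriv_one] at h₀ h₁
  exact ⟨max C₀ C₁, fun x => ⟨(h₀ x).trans (le_max_left _ _), (h₁ x).trans (le_max_right _ _)⟩⟩

section MatrixNorm

-- Any norm on the finite-dimensional space `Mat2` would do.
open scoped Matrix.Norms.Elementwise

theorem algebra_contDiff {a : Minkowski → Mat2} (ha : a ∈ algebra) : ContDiff ℝ ∞ a := by
  refine contDiff_pi.2 fun i => contDiff_pi.2 fun j => ?_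
  by_cases hij : i = j
  · exact hij ▸ scalarAlgebra_contDiff (ha.1 i)
  · obtain ⟨f, hf⟩ := ha.2 i j hij
    exact funext hf ▸ f.smooth ⊤

theorem algebra_differentiable {a : Minkowski → Mat2} (ha : a ∈ algebra) : Differentiable ℝ a :=
  (algebra_contDiff ha).differentiable (by simp)

theorem fderiv_matrix_entry {a : Minkowski → Mat2} {x : Minkowski}
    (ha : DifferentiableAt ℝ a x) (i j : Fin 2) (v : Minkowski) :
    fderiv ℝ (fun y => a y i j) x v = fderiv ℝ a x v i j := by
  have h : HasFDerivAt (fun y => a y i j) _ x :=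
    hasFDerivAt_pi'.1 (hasFDerivAt_pi'.1 ha.hasFDerivAt i) j
  rw [h.fderiv]
  rfl

theorem algebra_bounded {a : Minkowski → Mat2} (ha : a ∈ algebra) :
    ∃ C : ℝ, ∀ x, ‖a x‖ ≤ C ∧ ∀ v, ‖fderiv ℝ a x v‖ ≤ C * ‖v‖ := by
  have entry_bounded (i j : Fin 2) :
      ∃ C : ℝ, ∀ x, ‖a x i j‖ ≤ C ∧ ‖fderiv ℝ (fun y => a y i j) x‖ ≤ C := by
    by_cases hij : i = j
    · exact hij ▸ scalarAlgebra_bounded (ha.1 i)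
    · obtain ⟨f, hf⟩ := ha.2 i j hij
      simpa only [hf] using schwartzMap_bounded f
  choose C hC using entry_bounded
  obtain ⟨M, hM⟩ := (Set.finite_range fun ij : Fin 2 × Fin 2 => C ij.1 ij.2).bddAbove
  have hCM (i j : Fin 2) : C i j ≤ M := hM ⟨(i, j), rfl⟩
  have hM0 : 0 ≤ M := (norm_nonneg _).trans ((hC 0 0 0).1.trans (hCM 0 0))
  refine ⟨M, fun x => ⟨(Matrix.norm_le_iff hM0).2 fun i j => (hC i j x).1.trans (hCM i j),
    fun v => (Matrix.norm_le_iff (by positivity)).2 fun i j => ?_⟩⟩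
  rw [← fderiv_matrix_entry (algebra_differentiable ha x)]
  exact ContinuousLinearMap.le_of_opNorm_le _ ((hC i j x).2.trans (hCM i j)) v

end MatrixNorm

/-! ### The commutator as a multiplication operator -/

/-- The matrix by which the commutator `[D, a]` acts at a point. -/
def commSymbol (d₁ d₂ : ℝ) (a : Minkowski → Mat2) (x : Minkowski) :
    Matrix (Fin 2 × Fin 2) (Fin 2 × Fin 2) ℂ :=
  (-Complex.I) • (gamma0 ⊗ₖ fderiv ℝ a x (1, 0) + gamma1 ⊗ₖ fderiv ℝ a x (0, 1)) +
    (gamma0 * gamma1) ⊗ₖ ⁅finiteDirac d₁ d₂, a x⁆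

/-- The operator `A ⊗ b` on `ℂ² ⊗ ℂ²`, as a function of `b`. -/
def opTensor (A : Mat2) : Mat2 →ₗ[ℂ] Spinor →L[ℂ] Spinor :=
  (Matrix.toEuclideanCLM (n := Fin 2 × Fin 2) (𝕜 := ℂ)).toAlgEquiv.toLinearMap ∘ₗ
    Matrix.kroneckerBilinear (R := ℂ) A

theorem op_kronecker (A B : Mat2) : op (A ⊗ₖ B) = opTensor A B := rfl

theorem opTensor_opTensor (A B A' B' : Mat2) (ξ : Spinor) :
    opTensor A B (opTensor A' B' ξ) = opTensor (A * A') (B * B') ξ := by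
  simp only [← op_kronecker, Matrix.mul_kronecker_mul, op, map_mul, mul_apply_eq_comp]

theorem op_commSymbol (d₁ d₂ : ℝ) (a : Minkowski → Mat2) (x : Minkowski) :
    op (commSymbol d₁ d₂ a x) =
      (-Complex.I) • (opTensor gamma0 (fderiv ℝ a x (1, 0)) +
        opTensor gamma1 (fderiv ℝ a x (0, 1))) +
      opTensor (gamma0 * gamma1) ⁅finiteDirac d₁ d₂, a x⁆ := by
  simp only [commSymbol, ← op_kronecker, op, map_add, map_smul]

section MatrixNorm

open scoped Matrix.Norms.Elementwise

theorem fderiv_rep {a : Minkowski → Mat2} {φ : Minkowski → Spinor} {x : Minkowski}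
    (ha : DifferentiableAt ℝ a x) (hφ : DifferentiableAt ℝ φ x) (v : Minkowski) :
    fderiv ℝ (rep a φ) x v =
      opTensor 1 (fderiv ℝ a x v) (φ x) + opTensor 1 (a x) (fderiv ℝ φ x v) := by
  let T : Mat2 →L[ℝ] Spinor →L[ℝ] Spinor := LinearMap.toContinuousLinearMap
    (ContinuousLinearMap.restrictScalarsₗ ℂ Spinor Spinor ℝ ℝ ∘ₗ
      (opTensor 1).restrictScalars ℝ)
  have hrep : HasFDerivAt (rep a φ) _ x :=
    (T.hasFDerivAt.comp x ha.hasFDerivAt).clm_apply hφ.hasFDerivAt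
  rw [hrep.fderiv, add_comm]
  rfl

theorem commutator_apply (d₁ d₂ : ℝ) {a : Minkowski → Mat2} {φ : Minkowski → Spinor}
    {x : Minkowski} (ha : DifferentiableAt ℝ a x) (hφ : DifferentiableAt ℝ φ x) :
    dirac d₁ d₂ (rep a φ) x - rep a (dirac d₁ d₂ φ) x = op (commSymbol d₁ d₂ a x) (φ x) := by
  simp only [dirac, fderiv_rep ha hφ, op_commSymbol, rep, op_kronecker, map_add, map_smul,
    map_sub, Ring.lie_def, opTensor_opTensor, add_apply, sub_apply, smul_apply, mul_one, one_mul]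
  module

theorem exists_linearMap_op_commSymbol (d₁ d₂ : ℝ) :
    ∃ T : Mat2 × Mat2 × Mat2 →L[ℝ] Spinor →L[ℂ] Spinor,
      ∀ a x, op (commSymbol d₁ d₂ a x) =
        T (fderiv ℝ a x (1, 0), fderiv ℝ a x (0, 1), a x) := by
  let T : Mat2 × Mat2 × Mat2 →ₗ[ℂ] Spinor →L[ℂ] Spinor :=
    { toFun := fun m => (-Complex.I) • (opTensor gamma0 m.1 + opTensor gamma1 m.2.1) +
        opTensor (gamma0 * gamma1) ⁅finiteDirac d₁ d₂, m.2.2⁆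
      map_add' := fun m m' => by
        simp only [Prod.fst_add, Prod.snd_add, Ring.lie_def, mul_add, add_mul, map_add, map_sub]
        module
      map_smul' := fun c m => by
        simp only [Prod.smul_fst, Prod.smul_snd, Ring.lie_def, mul_smul_comm, smul_mul_assoc,
          map_sub, map_smul, RingHom.id_apply]
        module }
  exact ⟨LinearMap.toContinuousLinearMap (T.restrictScalars ℝ), op_commSymbol d₁ d₂⟩

theorem continuous_op_commSymbol (d₁ d₂ : ℝ) {a : Minkowski → Mat2} (ha : a ∈ algebra) :
    Continuous fun x => op (commSymbol d₁ d₂ a x) := by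
  obtain ⟨T, hT⟩ := exists_linearMap_op_commSymbol d₁ d₂
  simp only [hT]
  have hfderiv (v : Minkowski) : Continuous fun x => fderiv ℝ a x v :=
    ((algebra_contDiff ha).continuous_fderiv (by simp)).clm_apply continuous_const
  exact T.continuous.comp
    ((hfderiv _).prodMk ((hfderiv _).prodMk (algebra_contDiff ha).continuous))

theorem bounded_op_commSymbol (d₁ d₂ : ℝ) {a : Minkowski → Mat2} (ha : a ∈ algebra) :
    ∃ C : ℝ, ∀ x, ‖op (commSymbol d₁ d₂ a x)‖ ≤ C := by
  obtain ⟨T, hT⟩ := exists_linearMap_op_commSymbol d₁ d₂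
  obtain ⟨C, hC⟩ := algebra_bounded ha
  have hfderiv (x v : Minkowski) (hv : ‖v‖ = 1) : ‖fderiv ℝ a x v‖ ≤ C := by
    simpa only [hv, mul_one] using (hC x).2 v
  obtain ⟨K, hK⟩ := ((isCompact_closedBall (0 : Mat2 × Mat2 × Mat2) C).image
    T.continuous).isBounded.exists_norm_le
  refine ⟨K, fun x => hT a x ▸ hK _ (Set.mem_image_of_mem T (mem_closedBall_zero_iff.2 ?_))⟩
  exact max_le (hfderiv x _ (by simp [Prod.norm_def]))
    (max_le (hfderiv x _ (by simp [Prod.norm_def])) (hC x).1)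

end MatrixNorm

/-! ### Pointwise description of the causal cone -/

/-- The quadratic form `⟨ξ, J [D, a](x) ξ⟩` on spinors at the point `x`. -/
def causalForm (d₁ d₂ : ℝ) (a : Minkowski → Mat2) (x : Minkowski) (ξ : Spinor) : ℂ :=
  inner ℂ ξ (op ((Complex.I • gamma0) ⊗ₖ (1 : Mat2)) (op (commSymbol d₁ d₂ a x) ξ))

theorem causalForm_smul (d₁ d₂ : ℝ) (a : Minkowski → Mat2) (x : Minkowski) (c : ℝ) (ξ : Spinor) :
    causalForm d₁ d₂ a x (c • ξ) = ((c ^ 2 : ℝ) : ℂ) * causalForm d₁ d₂ a x ξ := by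
  rw [← Complex.coe_smul, causalForm, map_smul, map_smul, inner_smul_left, inner_smul_right,
    Complex.conj_ofReal, causalForm]
  push_cast
  ring

theorem continuous_causalForm (d₁ d₂ : ℝ) {a : Minkowski → Mat2} (ha : a ∈ algebra) (ξ : Spinor) :
    Continuous fun x => causalForm d₁ d₂ a x ξ := by
  have h := continuous_op_commSymbol d₁ d₂ ha
  unfold causalForm
  fun_prop

theorem inner_fundamentalSymmetry_eq_integral {d₁ d₂ : ℝ} {a : Minkowski → Mat2}
    {ψ χ : Hilbert} (h : χ =ᵐ[volume] fun x => op (commSymbol d₁ d₂ a x) (ψ x)) :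
    inner ℂ ψ (fundamentalSymmetry χ) = ∫ x, causalForm d₁ d₂ a x (ψ x) := by
  rw [L2.inner_def]
  refine integral_congr_ae ?_
  have hJ : fundamentalSymmetry χ =ᵐ[volume]
      fun x => op ((Complex.I • gamma0) ⊗ₖ (1 : Mat2)) (χ x) :=
    ContinuousLinearMap.coeFn_compLpL _ _
  filter_upwards [h, hJ] with x hx hJx
  rw [hJx, hx, causalForm]

theorem nonpos_of_integral_sq_smul_nonpos {E : Type*} [NormedAddCommGroup E] [NormedSpace ℝ E]
    [FiniteDimensional ℝ E] [MeasurableSpace E] [BorelSpace E] (μ : Measure E)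
    [IsFiniteMeasureOnCompacts μ] [μ.IsOpenPosMeasure] {f : E → ℝ} (hf : Continuous f)
    (h : ∀ χ : E → ℝ, ContDiff ℝ ∞ χ → HasCompactSupport χ → ∫ x, χ x ^ 2 * f x ∂μ ≤ 0) (x : E) :
    f x ≤ 0 := by
  by_contra! hpos
  obtain ⟨ε, hε, hball⟩ := Metric.isOpen_iff.1 (isOpen_lt continuous_const hf) x hpos
  let χ : ContDiffBump x := ⟨ε / 2, ε, by positivity, by linarith⟩
  have hχ : HasCompactSupport fun y => χ y ^ 2 * f y :=
    (χ.hasCompactSupport.comp_left (g := fun t : ℝ => t ^ 2) (by simp)).mul_right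
  refine (h χ χ.contDiff χ.hasCompactSupport).not_gt <|
    ((χ.continuous.pow 2).mul hf).integral_pos_of_hasCompactSupport_nonneg_nonzero hχ
      (x := x) (fun y => ?_) ?_
  · by_cases hy : y ∈ Metric.ball x ε
    · exact mul_nonneg (sq_nonneg _) (hball hy).le
    · have : χ y = 0 := Function.notMem_support.1 (χ.support_eq ▸ hy)
      simp [this]
  · have : χ x = 1 := χ.one_of_mem_closedBall (Metric.mem_closedBall_self χ.rIn_pos.le)
    simpa [this] using hpos.ne'

theorem causalForm_re_nonpos {d₁ d₂ : ℝ} {a : algebra} (ha : a ∈ causalCone d₁ d₂)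
    (x : Minkowski) (ξ : Spinor) : (causalForm d₁ d₂ a.1 x ξ).re ≤ 0 := by
  obtain ⟨-, B, hB, hneg⟩ := ha
  have hcont := continuous_causalForm d₁ d₂ a.2 ξ
  refine nonpos_of_integral_sq_smul_nonpos volume (Complex.continuous_re.comp hcont)
    (fun χ hχ hχc => ?_) x
  let φ : Minkowski → Spinor := fun y => χ y • ξ
  have hφ : ContDiff ℝ ∞ φ := hχ.smul contDiff_const
  have hφc : HasCompactSupport φ := hχc.smul_right
  have hmem : MemLp φ 2 (volume : Measure Minkowski) :=
    hφ.continuous.memLp_of_hasCompactSupport hφc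
  have hψ := hmem.coeFn_toLp
  have hBψ : B (hmem.toLp φ) =ᵐ[volume]
      fun y => op (commSymbol d₁ d₂ a.1 y) (hmem.toLp φ y) := by
    filter_upwards [hB φ hφ hφc _ hψ, hψ] with y hBy hy
    rw [hBy, hy, commutator_apply d₁ d₂ (algebra_differentiable a.2 y)
      (hφ.differentiable (by simp) y)]
  have hinner : inner ℂ (hmem.toLp φ) (fundamentalSymmetry (B (hmem.toLp φ))) =
      ∫ y, ((χ y ^ 2 : ℝ) : ℂ) * causalForm d₁ d₂ a.1 y ξ := by
    rw [inner_fundamentalSymmetry_eq_integral hBψ]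
    refine integral_congr_ae ?_
    filter_upwards [hψ] with y hy
    rw [hy, causalForm_smul]
  have hint : Integrable fun y => ((χ y ^ 2 : ℝ) : ℂ) * causalForm d₁ d₂ a.1 y ξ := by
    have hχ2 : HasCompactSupport fun y => ((χ y ^ 2 : ℝ) : ℂ) :=
      hχc.comp_left (g := fun t : ℝ => ((t ^ 2 : ℝ) : ℂ)) (by simp)
    have := hχ.continuous
    exact Continuous.integrable_of_hasCompactSupport (by fun_prop) hχ2.mul_right
  calc ∫ y, χ y ^ 2 * (causalForm d₁ d₂ a.1 y ξ).re
      = (inner ℂ (hmem.toLp φ) (fundamentalSymmetry (B (hmem.toLp φ)))).re := by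
        rw [hinner]
        simpa only [RCLike.re_to_complex, Complex.re_ofReal_mul] using integral_re hint
    _ ≤ 0 := (Complex.le_def.1 (hneg _)).1

theorem mem_causalCone {d₁ d₂ : ℝ} {a : algebra} (hherm : ∀ x, (a.1 x).IsHermitian)
    (hneg : ∀ x ξ, causalForm d₁ d₂ a.1 x ξ ≤ 0) : a ∈ causalCone d₁ d₂ := by
  obtain ⟨C, hC⟩ := bounded_op_commSymbol d₁ d₂ a.2
  have hmem : MemLp (fun x => op (commSymbol d₁ d₂ a.1 x)) ⊤ (volume : Measure Minkowski) :=
    memLp_top_of_bound (continuous_op_commSymbol d₁ d₂ a.2).aestronglyMeasurable C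
      (.of_forall hC)
  let E : (Spinor →L[ℂ] Spinor) →L[ℂ] Spinor →L[ℂ] Spinor := ContinuousLinearMap.id ℂ _
  let B : Hilbert →L[ℂ] Hilbert := E.holderL volume ⊤ 2 2 (hmem.toLp _)
  have hB (ψ : Hilbert) : B ψ =ᵐ[volume] fun x => op (commSymbol d₁ d₂ a.1 x) (ψ x) := by
    filter_upwards [E.coeFn_holder (r := 2) (hmem.toLp _) ψ, hmem.coeFn_toLp] with x hx hSx
    change E.holder 2 (hmem.toLp _) ψ x = _
    rw [hx, hSx]
    rfl
  refine ⟨hherm, B, fun φ hφ _ ψ hψ => ?_, fun ψ => ?_⟩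
  · filter_upwards [hB ψ, hψ] with x hBx hx
    rw [hBx, hx, commutator_apply d₁ d₂ (algebra_differentiable a.2 x)
      (hφ.differentiable (by simp) x)]
  · have hreal (x : Minkowski) : causalForm d₁ d₂ a.1 x (ψ x) =
        ((causalForm d₁ d₂ a.1 x (ψ x)).re : ℂ) :=
      Complex.ext rfl (Complex.le_def.1 (hneg x (ψ x))).2
    rw [inner_fundamentalSymmetry_eq_integral (hB ψ), integral_congr_ae (.of_forall hreal),
      integral_complex_ofReal]
    exact_mod_cast integral_nonpos fun x => (Complex.le_def.1 (hneg x (ψ x))).1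

theorem causalForm_eq (d₁ d₂ : ℝ) (a : Minkowski → Mat2) (x : Minkowski) (u w : Fin 2 → ℂ) :
    causalForm d₁ d₂ a x (WithLp.toLp 2 fun k => ![u, w] k.1 k.2) =
      -(star u ⬝ᵥ fderiv ℝ a x (1, 1) *ᵥ u) - star w ⬝ᵥ fderiv ℝ a x (1, -1) *ᵥ w -
        (star u ⬝ᵥ ⁅finiteDirac d₁ d₂, a x⁆ *ᵥ w - star w ⬝ᵥ ⁅finiteDirac d₁ d₂, a x⁆ *ᵥ u) := by
  have hplus : ((1, 1) : Minkowski) = (1, 0) + (0, 1) := by simp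
  have hminus : ((1, -1) : Minkowski) = (1, 0) - (0, 1) := by simp
  rw [hplus, hminus, map_add, map_sub, causalForm, commSymbol]
  generalize ⁅finiteDirac d₁ d₂, a x⁆ = K
  simp only [op, PiLp.inner_apply, Matrix.ofLp_toEuclideanCLM, Matrix.mulVec, dotProduct,
    Fintype.sum_prod_type, Fin.sum_univ_two, gamma0, gamma1, Matrix.kroneckerMap_apply,
    Matrix.add_apply, Matrix.sub_apply, Matrix.smul_apply, smul_eq_mul, Matrix.mul_apply,
    Matrix.of_apply, Matrix.one_apply, Matrix.cons_val_zero, Matrix.cons_val_one,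
    Matrix.cons_val', Matrix.cons_val_fin_one, RCLike.inner_apply, Pi.star_apply,
    starRingEnd_apply]
  simp only [Fin.isValue, reduceIte, one_ne_zero, zero_ne_one, mul_zero, zero_mul, add_zero,
    zero_add, mul_one]
  ring_nf
  simp only [Complex.I_pow_four]
  ring

open scoped Matrix.Norms.Elementwise in
theorem fderiv_isHermitian {a : Minkowski → Mat2} (ha : ∀ x, (a x).IsHermitian)
    (x v : Minkowski) : (fderiv ℝ a x v).IsHermitian := by
  have hstar : fderiv ℝ (fun y => star (a y)) x = _ := fderiv_star
  rw [show (fun y => star (a y)) = a from funext ha] at hstar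
  exact (DFunLike.congr_fun hstar v).symm

/-! ### The Bloch ball -/

/-- The expectation value of a Hermitian matrix in the state with Bloch vector
`(re c, im c, z)`. -/
def blochValue (A : Mat2) (z : ℝ) (c : ℂ) : ℝ :=
  ((1 + z) / 2 * A 0 0 + (1 - z) / 2 * A 1 1 + c * A 0 1).re

theorem isHermitian_apply_one_zero {A : Mat2} (hA : A.IsHermitian) : A 1 0 = star (A 0 1) :=
  (hA.apply 1 0).symm

theorem sqrt_one_sub_sq {z : ℝ} (hz : |z| ≤ 1) :
    √(1 - z ^ 2) = 2 * (√((1 + z) / 2) * √((1 - z) / 2)) := by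
  have h : 0 ≤ (1 + z) / 2 := by linarith [(abs_le.1 hz).1]
  rw [← Real.sqrt_mul h, ← Real.sqrt_sq zero_le_two, ← Real.sqrt_mul (by positivity)]
  congr 1
  norm_num
  ring

/-- The unit vector whose Bloch vector has height `z` and azimuth `θ`. -/
def pureVector (z θ : ℝ) : Fin 2 → ℂ :=
  ![√((1 + z) / 2), √((1 - z) / 2) * Complex.exp (θ * Complex.I)]

theorem conj_exp_ofReal_mul_I (θ : ℝ) :
    (starRingEnd ℂ) (Complex.exp (θ * Complex.I)) * Complex.exp (θ * Complex.I) = 1 := by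
  rw [← Complex.normSq_eq_conj_mul_self, Complex.normSq_eq_norm_sq,
    Complex.norm_exp_ofReal_mul_I, one_pow, Complex.ofReal_one]

theorem dotProduct_mulVec_pureVector {A : Mat2} (hA : A.IsHermitian) {z : ℝ} (hz : |z| ≤ 1)
    (θ : ℝ) :
    (star (pureVector z θ) ⬝ᵥ A *ᵥ pureVector z θ).re =
      blochValue A z (√(1 - z ^ 2) * Complex.exp (θ * Complex.I)) := by
  have hplus : (√((1 + z) / 2) : ℂ) * √((1 + z) / 2) = (1 + z) / 2 :=
    mod_cast Real.mul_self_sqrt (by linarith [(abs_le.1 hz).1])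
  have hminus : (√((1 - z) / 2) : ℂ) * √((1 - z) / 2) = (1 - z) / 2 :=
    mod_cast Real.mul_self_sqrt (by linarith [(abs_le.1 hz).2])
  have he := conj_exp_ofReal_mul_I θ
  rw [sqrt_one_sub_sq hz, pureVector, blochValue]
  generalize √((1 + z) / 2) = s at *
  generalize √((1 - z) / 2) = t at *
  generalize Complex.exp (θ * Complex.I) = e at *
  have hform : star ![(s : ℂ), t * e] ⬝ᵥ A *ᵥ ![(s : ℂ), t * e] =
      (1 + z) / 2 * A 0 0 + (1 - z) / 2 * A 1 1 +
        (s * t * e * A 0 1 + (starRingEnd ℂ) (s * t * e * A 0 1)) := by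
    simp only [Matrix.mulVec, dotProduct, Fin.sum_univ_two, isHermitian_apply_one_zero hA,
      Pi.star_apply, Matrix.cons_val_zero, Matrix.cons_val_one, ← starRingEnd_apply, map_mul,
      Complex.conj_ofReal]
    linear_combination A 0 0 * hplus + A 1 1 * hminus + A 1 1 * t * t * he
  rw [hform, Complex.add_conj]
  push_cast
  simp [mul_assoc]

theorem dotProduct_commutator_pureVector {A : Mat2} (hA : A.IsHermitian) {z : ℝ} (hz : |z| ≤ 1)
    (θ d₁ d₂ : ℝ) :
    (Complex.I * (star (pureVector z θ) ⬝ᵥ ⁅finiteDirac d₁ d₂, A⁆ *ᵥ pureVector z θ)).re =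
      (d₁ - d₂) * (√(1 - z ^ 2) * Complex.exp (θ * Complex.I) * Complex.I * A 0 1).re := by
  rw [sqrt_one_sub_sq hz, pureVector]
  generalize √((1 + z) / 2) = s
  generalize √((1 - z) / 2) = t
  generalize Complex.exp (θ * Complex.I) = e
  have hform : star ![(s : ℂ), t * e] ⬝ᵥ ⁅finiteDirac d₁ d₂, A⁆ *ᵥ ![(s : ℂ), t * e] =
      ((d₁ - d₂ : ℝ) : ℂ) * (s * t * e * A 0 1 - (starRingEnd ℂ) (s * t * e * A 0 1)) := by
    simp only [finiteDirac, Ring.lie_def, Matrix.mulVec, dotProduct, Fin.sum_univ_two,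
      Matrix.sub_apply, Matrix.diagonal_mul, Matrix.mul_diagonal, isHermitian_apply_one_zero hA,
      Pi.star_apply, Matrix.cons_val_zero, Matrix.cons_val_one, ← starRingEnd_apply, map_mul,
      Complex.conj_ofReal]
    push_cast
    ring
  rw [hform, Complex.sub_conj, mul_left_comm, Complex.re_ofReal_mul]
  simp
  ring

/-! ### The velocity inequality -/

theorem IsFutureCausal.abs_snd_le {v : Minkowski} (hv : IsFutureCausal v) : |v.2| ≤ v.1 := by
  obtain ⟨hmetric, hpos⟩ := hv
  refine abs_le_of_sq_le_sq ?_ hpos.le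
  rw [metric] at hmetric
  linarith

theorem neg_metric_self (v : Minkowski) : -metric v v = (v.1 + v.2) * (v.1 - v.2) := by
  rw [metric]
  ring

theorem lightCone_decomposition (v : Minkowski) :
    (2 : ℝ) • v = (v.1 + v.2) • ((1, 1) : Minkowski) + (v.1 - v.2) • ((1, -1) : Minkowski) := by
  ext <;> simp <;> ring

theorem abs_dotProduct_commutator_le {d₁ d₂ : ℝ} {a : algebra} (ha : a ∈ causalCone d₁ d₂)
    (x : Minkowski) {v : Minkowski} (hv : |v.2| ≤ v.1) (u : Fin 2 → ℂ) :
    √(-metric v v) * |(Complex.I * (star u ⬝ᵥ ⁅finiteDirac d₁ d₂, a.1 x⁆ *ᵥ u)).re| ≤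
      (star u ⬝ᵥ fderiv ℝ a.1 x v *ᵥ u).re := by
  have hplus : 0 ≤ v.1 + v.2 := by linarith [(abs_le.1 hv).1]
  have hminus : 0 ≤ v.1 - v.2 := by linarith [(abs_le.1 hv).2]
  have hv2 : 2 * (star u ⬝ᵥ fderiv ℝ a.1 x v *ᵥ u).re =
      (v.1 + v.2) * (star u ⬝ᵥ fderiv ℝ a.1 x (1, 1) *ᵥ u).re +
        (v.1 - v.2) * (star u ⬝ᵥ fderiv ℝ a.1 x (1, -1) *ᵥ u).re := by
    have := congrArg (fun w => (star u ⬝ᵥ fderiv ℝ a.1 x w *ᵥ u).re) (lightCone_decomposition v)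
    simpa only [map_add, map_smul, Matrix.add_mulVec, Matrix.smul_mulVec, dotProduct_add,
      dotProduct_smul, Complex.add_re, Complex.smul_re, smul_eq_mul] using this
  have signed (ε : ℝ) (hε : ε ^ 2 = 1) : ε * (√(v.1 + v.2) * √(v.1 - v.2) *
      (Complex.I * (star u ⬝ᵥ ⁅finiteDirac d₁ d₂, a.1 x⁆ *ᵥ u)).re) ≤
        (star u ⬝ᵥ fderiv ℝ a.1 x v *ᵥ u).re := by
    have h := causalForm_re_nonpos ha x (WithLp.toLp 2 fun k =>
      ![(√(v.1 + v.2) : ℂ) • u, (-ε * √(v.1 - v.2) * Complex.I : ℂ) • u] k.1 k.2)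
    rw [causalForm_eq] at h
    simp only [star_smul, smul_dotProduct, Matrix.mulVec_smul, dotProduct_smul] at h
    generalize star u ⬝ᵥ fderiv ℝ a.1 x (1, 1) *ᵥ u = P at *
    generalize star u ⬝ᵥ fderiv ℝ a.1 x (1, -1) *ᵥ u = M at *
    generalize star u ⬝ᵥ ⁅finiteDirac d₁ d₂, a.1 x⁆ *ᵥ u = K at *
    have hp := Real.mul_self_sqrt hplus
    have hm := Real.mul_self_sqrt hminus
    generalize √(v.1 + v.2) = s at *
    generalize √(v.1 - v.2) = t at *
    simp only [← starRingEnd_apply, Complex.conj_ofReal, smul_eq_mul, map_neg, map_mul,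
      Complex.conj_I, Complex.sub_re, Complex.neg_re, Complex.neg_im, Complex.mul_re,
      Complex.mul_im, Complex.ofReal_re, Complex.ofReal_im, Complex.I_re, Complex.I_im] at h
    rw [Complex.I_mul_re]
    linear_combination (h - hv2 + hp * P.re + hm * M.re + hε * t * t * M.re) / 2
  rw [neg_metric_self, Real.sqrt_mul hplus]
  rcases abs_choice (Complex.I * (star u ⬝ᵥ ⁅finiteDirac d₁ d₂, a.1 x⁆ *ᵥ u)).re with h | h
  · rw [h]
    linarith [signed 1 (by norm_num)]
  · rw [h]
    linarith [signed (-1) (by norm_num)]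

theorem velocity_inequality {d₁ d₂ : ℝ} {a : algebra} (ha : a ∈ causalCone d₁ d₂)
    (x : Minkowski) {v : Minkowski} (hv : |v.2| ≤ v.1) {z : ℝ} (hz : |z| ≤ 1) (θ : ℝ)
    {κ : ℝ} (hκ : |κ| ≤ |d₁ - d₂|) :
    0 ≤ blochValue (fderiv ℝ a.1 x v) z (√(1 - z ^ 2) * Complex.exp (θ * Complex.I)) +
      κ * √(-metric v v) *
        (√(1 - z ^ 2) * Complex.exp (θ * Complex.I) * Complex.I * a.1 x 0 1).re := by
  have h := abs_dotProduct_commutator_le ha x hv (pureVector z θ)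
  rw [dotProduct_mulVec_pureVector (fderiv_isHermitian ha.1 x v) hz,
    dotProduct_commutator_pureVector (ha.1 x) hz, abs_mul] at h
  set Y := (√(1 - z ^ 2) * Complex.exp (θ * Complex.I) * Complex.I * a.1 x 0 1).re
  have hκY : |κ * √(-metric v v) * Y| ≤ √(-metric v v) * (|d₁ - d₂| * |Y|) := by
    rw [abs_mul, abs_mul, abs_of_nonneg (Real.sqrt_nonneg _), mul_right_comm, mul_comm]
    gcongr
  linarith [neg_abs_le (κ * √(-metric v v) * Y)]

/-! ### Transport of states along causal curves -/

/-- The proper time elapsed along a curve on `[0, T]` at the parameter `t`. -/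
def elapsed (γ : ℝ → Minkowski) (T t : ℝ) : ℝ :=
  ∫ u in (0 : ℝ)..t, √(-metric (velocity γ T u) (velocity γ T u))

theorem elapsed_zero (γ : ℝ → Minkowski) (T : ℝ) : elapsed γ T 0 = 0 :=
  intervalIntegral.integral_same

theorem properTime_nonneg {γ : ℝ → Minkowski} {T : ℝ} (hT : 0 ≤ T) : 0 ≤ properTime γ T :=
  intervalIntegral.integral_nonneg hT fun _ _ => Real.sqrt_nonneg _

theorem hasDerivWithinAt_causalCurve {γ : ℝ → Minkowski} {T : ℝ} (hγ : IsCausalCurve γ T)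
    {t : ℝ} (ht : t ∈ Set.Icc 0 T) :
    HasDerivWithinAt γ (velocity γ T t) (Set.Icc 0 T) t :=
  (hγ.2.1.differentiableOn one_ne_zero t ht).hasDerivWithinAt

theorem hasDerivWithinAt_elapsed {γ : ℝ → Minkowski} {T : ℝ} (hγ : IsCausalCurve γ T)
    (hT : 0 < T) {t : ℝ} (ht : t ∈ Set.Icc 0 T) :
    HasDerivWithinAt (elapsed γ T) √(-metric (velocity γ T t) (velocity γ T t))
      (Set.Icc 0 T) t := by
  have hvel : ContinuousOn (velocity γ T) (Set.Icc 0 T) :=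
    hγ.2.1.continuousOn_derivWithin (uniqueDiffOn_Icc hT) le_rfl
  have hspeed : ContinuousOn (fun u => √(-metric (velocity γ T u) (velocity γ T u)))
      (Set.Icc 0 T) := by
    unfold metric
    fun_prop
  have : Fact (t ∈ Set.Icc 0 T) := ⟨ht⟩
  refine intervalIntegral.integral_hasDerivWithinAt_right
    ((hspeed.mono ?_).intervalIntegrable_of_Icc ht.1)
    ⟨Set.Icc 0 T, self_mem_nhdsWithin, hspeed.aestronglyMeasurable measurableSet_Icc⟩
    (hspeed t ht)
  exact Set.Icc_subset_Icc_right ht.2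

theorem hasDerivWithinAt_re {f : ℝ → ℂ} {f' : ℂ} {s : Set ℝ} {t : ℝ}
    (hf : HasDerivWithinAt f f' s t) : HasDerivWithinAt (fun u => (f u).re) f'.re s t :=
  Complex.reCLM.hasFDerivAt.comp_hasDerivWithinAt t hf

open scoped Matrix.Norms.Elementwise in
theorem hasDerivWithinAt_blochValue {f : ℝ → Mat2} {f' : Mat2} {θ : ℝ → ℝ} {θ' t : ℝ}
    {s : Set ℝ} (hf : HasDerivWithinAt f f' s t) (hθ : HasDerivWithinAt θ θ' s t) (z N : ℝ) :
    HasDerivWithinAt (fun u => blochValue (f u) z (N * Complex.exp (θ u * Complex.I)))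
      (blochValue f' z (N * Complex.exp (θ t * Complex.I)) +
        θ' * (N * Complex.exp (θ t * Complex.I) * Complex.I * f t 0 1).re) s t := by
  have hentry (i j : Fin 2) : HasDerivWithinAt (fun u => f u i j) (f' i j) s t :=
    hasDerivWithinAt_pi.1 (hasDerivWithinAt_pi.1 hf i) j
  have hphase := ((hθ.ofReal_comp.mul_const Complex.I).cexp.const_mul (N : ℂ)).mul (hentry 0 1)
  have h := hasDerivWithinAt_re ((((hentry 0 0).const_mul ((1 + z : ℂ) / 2)).add
    ((hentry 1 1).const_mul ((1 - z : ℂ) / 2))).add hphase)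
  refine h.congr_deriv ?_
  rw [blochValue, ← Complex.re_ofReal_mul, ← Complex.add_re]
  congr 1
  ring

open scoped Matrix.Norms.Elementwise in
theorem monotoneOn_transport {d₁ d₂ : ℝ} {a : algebra} (ha : a ∈ causalCone d₁ d₂)
    {γ : ℝ → Minkowski} {T : ℝ} (hγ : IsCausalCurve γ T) {z : ℝ} (hz : |z| ≤ 1)
    (α : ℝ) {κ : ℝ} (hκ : |κ| ≤ |d₁ - d₂|) :
    MonotoneOn (fun t => blochValue (a.1 (γ t)) z
      (√(1 - z ^ 2) * Complex.exp ((α + κ * elapsed γ T t : ℝ) * Complex.I))) (Set.Icc 0 T) := by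
  rcases hγ.1.eq_or_lt with rfl | hT
  · rw [Set.Icc_self]
    exact Set.subsingleton_singleton.monotoneOn _
  have hderiv (t : ℝ) (ht : t ∈ Set.Icc 0 T) := hasDerivWithinAt_blochValue
    (((algebra_differentiable a.2 (γ t)).hasFDerivAt.comp_hasDerivWithinAt t
      (hasDerivWithinAt_causalCurve hγ ht)))
    (((hasDerivWithinAt_elapsed hγ hT ht).const_mul κ).const_add α) z √(1 - z ^ 2)
  refine monotoneOn_of_hasDerivWithinAt_nonneg (convex_Icc 0 T)
    (fun t ht => (hderiv t ht).continuousWithinAt)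
    (fun t ht => (hderiv t (interior_subset ht)).mono interior_subset) fun t ht => ?_
  exact velocity_inequality ha (γ t) (hγ.2.2 hT t (interior_subset ht)).abs_snd_le hz _ hκ

theorem exists_rate {δ l D : ℝ} (hl : 0 ≤ l) (h : |δ| ≤ l * D) (hD : 0 ≤ D) :
    ∃ κ, |κ| ≤ D ∧ κ * l = δ := by
  rcases hl.eq_or_lt with rfl | hl
  · exact ⟨0, by rwa [abs_zero], by rw [zero_mul] at h ⊢; exact (abs_nonpos_iff.1 h).symm⟩
  · exact ⟨δ / l, by rwa [abs_div, abs_of_pos hl, div_le_iff₀' hl], div_mul_cancel₀ _ hl.ne'⟩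

theorem blochValue_le_of_phase {d₁ d₂ : ℝ} {a : algebra} (ha : a ∈ causalCone d₁ d₂)
    {γ : ℝ → Minkowski} {T : ℝ} (hγ : IsCausalCurve γ T) {z : ℝ} (hz : |z| ≤ 1)
    {α α' : ℝ} (h : |α' - α| ≤ properTime γ T * |d₁ - d₂|) :
    blochValue (a.1 (γ 0)) z (√(1 - z ^ 2) * Complex.exp (α * Complex.I)) ≤
      blochValue (a.1 (γ T)) z (√(1 - z ^ 2) * Complex.exp (α' * Complex.I)) := by
  obtain ⟨κ, hκ, hκl⟩ := exists_rate (properTime_nonneg hγ.1) h (abs_nonneg _)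
  have hmono := monotoneOn_transport ha hγ hz α hκ ⟨le_rfl, hγ.1⟩ ⟨hγ.1, le_rfl⟩ hγ.1
  have hend : α + κ * elapsed γ T T = α' := by
    rw [show elapsed γ T T = properTime γ T from rfl, hκl, add_sub_cancel]
  simpa only [elapsed_zero, mul_zero, add_zero, hend] using hmono

/-! ### Mixed states -/

theorem exists_re_mul_le_of_norm_le_one {w : ℂ} (hw : ‖w‖ ≤ 1) (m : ℂ) :
    ∃ ε : ℝ, |ε| = 1 ∧
      (w * m).re ≤ (Complex.exp ((ε * Real.arccos w.re : ℝ) * Complex.I) * m).re := by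
  obtain ⟨hre, hre'⟩ := abs_le.1 ((Complex.abs_re_le_norm w).trans hw)
  have him : |w.im| ≤ √(1 - w.re ^ 2) := by
    refine Real.abs_le_sqrt ?_
    have : Complex.normSq w ≤ 1 := by
      rw [Complex.normSq_eq_norm_sq]
      exact pow_le_one₀ (norm_nonneg w) hw
    rw [Complex.normSq_apply] at this
    linarith
  have hprod : -(w.im * m.im) ≤ √(1 - w.re ^ 2) * |m.im| :=
    (neg_le_abs _).trans (by rw [abs_mul]; gcongr)
  rcases abs_choice m.im with hm | hm
  · refine ⟨-1, by simp, ?_⟩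
    rw [Complex.mul_re, Complex.mul_re, Complex.exp_ofReal_mul_I_re, Complex.exp_ofReal_mul_I_im,
      neg_one_mul, Real.cos_neg, Real.sin_neg, Real.cos_arccos hre hre', Real.sin_arccos]
    rw [hm] at hprod
    linarith
  · refine ⟨1, abs_one, ?_⟩
    rw [Complex.mul_re, Complex.mul_re, Complex.exp_ofReal_mul_I_re, Complex.exp_ofReal_mul_I_im,
      one_mul, Real.cos_arccos hre hre', Real.sin_arccos]
    rw [hm] at hprod
    linarith

theorem exp_ofReal_sub_mul_I (α ψ : ℝ) : Complex.exp ((α - ψ : ℝ) * Complex.I) =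
    Complex.exp (α * Complex.I) * (starRingEnd ℂ) (Complex.exp (ψ * Complex.I)) := by
  rw [← Complex.exp_conj, ← Complex.exp_add]
  congr 1
  simp
  ring

theorem exists_conj_exp_mul_eq_neg_norm (c : ℂ) :
    ∃ ψ : ℝ, (starRingEnd ℂ) (Complex.exp (ψ * Complex.I)) * c = (-‖c‖ : ℝ) := by
  refine ⟨Complex.arg (-c), ?_⟩
  have hpolar : ‖c‖ * Complex.exp (Complex.arg (-c) * Complex.I) = -c := by
    rw [← norm_neg]
    exact Complex.norm_mul_exp_arg_mul_I (-c)
  push_cast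
  linear_combination (starRingEnd ℂ) (Complex.exp (Complex.arg (-c) * Complex.I)) * hpolar -
    ‖c‖ * conj_exp_ofReal_mul_I (Complex.arg (-c))

theorem disc_inequality_of_circle {V V' L : ℝ} {b b' : ℂ}
    (h : ∀ α α' : ℝ, |α' - α| ≤ L → V + (Complex.exp (α * Complex.I) * b).re ≤
      V' + (Complex.exp (α' * Complex.I) * b').re)
    {w w' : ℂ} (hw : ‖w‖ ≤ 1) (hw' : ‖w'‖ ≤ 1)
    (hL : ∀ θ : ℝ, |Real.arccos (w' * Complex.exp (θ * Complex.I)).re -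
      Real.arccos (w * Complex.exp (θ * Complex.I)).re| ≤ L) :
    V + (w * b).re ≤ V' + (w' * b').re := by
  obtain ⟨ψ, hb'⟩ := exists_conj_exp_mul_eq_neg_norm b'
  have hL := hL ψ
  have he1 := Complex.norm_exp_ofReal_mul_I ψ
  have hee := (mul_comm _ _).trans (conj_exp_ofReal_mul_I ψ)
  have hfactor := exp_ofReal_sub_mul_I (ψ := ψ)
  generalize Complex.exp (ψ * Complex.I) = e at *
  have hdisc {c : ℂ} (hc : ‖c‖ ≤ 1) : ‖c * e‖ ≤ 1 := by rwa [norm_mul, he1, mul_one]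
  obtain ⟨ε, hε, hle⟩ := exists_re_mul_le_of_norm_le_one (hdisc hw) ((starRingEnd ℂ) e * b)
  have hy := abs_le.1 ((Complex.abs_re_le_norm (w' * e)).trans (hdisc hw'))
  have hcos : Real.cos (ε * Real.arccos (w' * e).re) = (w' * e).re := by
    rw [← Real.cos_abs, abs_mul, hε, one_mul, Real.cos_abs, Real.cos_arccos hy.1 hy.2]
  calc V + (w * b).re = V + (w * e * ((starRingEnd ℂ) e * b)).re := by
        rw [mul_assoc, ← mul_assoc e, hee, one_mul]
    _ ≤ V + (Complex.exp ((ε * Real.arccos (w * e).re - ψ : ℝ) * Complex.I) * b).re := by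
        rw [hfactor, mul_assoc (Complex.exp _)]
        exact add_le_add_right hle V
    _ ≤ V' + (Complex.exp ((ε * Real.arccos (w' * e).re - ψ : ℝ) * Complex.I) * b').re := by
        refine h _ _ ?_
        rwa [sub_sub_sub_cancel_right, ← mul_sub, abs_mul, hε, one_mul]
    _ = V' + (w' * e * ((starRingEnd ℂ) e * b')).re := by
        rw [hfactor, mul_assoc, hb', Complex.re_mul_ofReal, Complex.re_mul_ofReal,
          Complex.exp_ofReal_mul_I_re, hcos]
    _ = V' + (w' * b').re := by rw [mul_assoc, ← mul_assoc e, hee, one_mul]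

theorem blochValue_le_of_arccos {d₁ d₂ : ℝ} {a : algebra} (ha : a ∈ causalCone d₁ d₂)
    {γ : ℝ → Minkowski} {T : ℝ} (hγ : IsCausalCurve γ T) {z : ℝ} (hz : |z| ≤ 1)
    {w w' : ℂ} (hw : ‖w‖ ≤ 1) (hw' : ‖w'‖ ≤ 1)
    (hL : ∀ θ : ℝ, |Real.arccos (w' * Complex.exp (θ * Complex.I)).re -
      Real.arccos (w * Complex.exp (θ * Complex.I)).re| ≤ properTime γ T * |d₁ - d₂|) :
    blochValue (a.1 (γ 0)) z (√(1 - z ^ 2) * w) ≤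
      blochValue (a.1 (γ T)) z (√(1 - z ^ 2) * w') := by
  have hassoc (A : Mat2) (c : ℂ) : blochValue A z (√(1 - z ^ 2) * c) =
      ((1 + z) / 2 * A 0 0 + (1 - z) / 2 * A 1 1).re + (c * (√(1 - z ^ 2) * A 0 1)).re := by
    rw [blochValue, Complex.add_re, mul_right_comm, mul_comm c, mul_assoc]
  rw [hassoc, hassoc]
  refine disc_inequality_of_circle (fun α α' hα => ?_) hw hw' hL
  rw [← hassoc, ← hassoc]
  exact blochValue_le_of_phase ha hγ hz hα

/-! ### Causal functions of one linear coordinate -/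

theorem map_nonneg_of_isFutureCausal {ℓ : Minkowski →L[ℝ] ℝ} (hp : 0 ≤ ℓ (1, 1))
    (hm : 0 ≤ ℓ (1, -1)) {v : Minkowski} (hv : IsFutureCausal v) : 0 ≤ ℓ v := by
  obtain ⟨hneg, hpos⟩ := abs_le.1 hv.abs_snd_le
  have h : 2 * ℓ v = (v.1 + v.2) * ℓ (1, 1) + (v.1 - v.2) * ℓ (1, -1) := by
    simpa only [map_add, map_smul, smul_eq_mul] using congrArg ℓ (lightCone_decomposition v)
  have := mul_nonneg (neg_le_iff_add_nonneg'.1 (neg_le.1 hneg)) hp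
  have := mul_nonneg (sub_nonneg.2 hpos) hm
  linarith

theorem isCausalFunction_comp_linear {g : ℝ → ℝ} (hg : Monotone g) {ℓ : Minkowski →L[ℝ] ℝ}
    (hp : 0 ≤ ℓ (1, 1)) (hm : 0 ≤ ℓ (1, -1)) : IsCausalFunction fun x => g (ℓ x) := by
  intro γ T hγ
  refine hg.comp_monotoneOn (f := fun t => ℓ (γ t)) ?_
  rcases hγ.1.eq_or_lt with rfl | hT
  · rw [Set.Icc_self]
    exact Set.subsingleton_singleton.monotoneOn _
  have hderiv (t : ℝ) (ht : t ∈ Set.Icc 0 T) :=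
    ℓ.hasFDerivAt.comp_hasDerivWithinAt t (hasDerivWithinAt_causalCurve hγ ht)
  exact monotoneOn_of_hasDerivWithinAt_nonneg (convex_Icc 0 T)
    (fun t ht => (hderiv t ht).continuousWithinAt)
    (fun t ht => (hderiv t (interior_subset ht)).mono interior_subset)
    fun t ht => map_nonneg_of_isFutureCausal hp hm (hγ.2.2 hT t (interior_subset ht))

theorem bounded_of_hasCompactSupport_deriv {g : ℝ → ℝ} (hg : ContDiff ℝ 1 g)
    (hc : HasCompactSupport (deriv g)) : ∃ C : ℝ, ∀ t, ‖g t‖ ≤ C := by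
  have hcont : Continuous (deriv g) := hg.continuous_deriv le_rfl
  refine ⟨‖g 0‖ + ∫ t, ‖deriv g t‖, fun t => ?_⟩
  have hsub : ∫ u in (0 : ℝ)..t, deriv g u = g t - g 0 :=
    intervalIntegral.integral_deriv_eq_sub (fun u _ => hg.differentiable one_ne_zero u)
      (hcont.intervalIntegrable 0 t)
  calc ‖g t‖ = ‖g 0 + ∫ u in (0 : ℝ)..t, deriv g u‖ := by rw [hsub, add_sub_cancel]
    _ ≤ ‖g 0‖ + ∫ t, ‖deriv g t‖ := norm_add_le_of_le le_rfl <|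
        intervalIntegral.norm_integral_le_integral_norm_uIoc.trans <|
          setIntegral_le_integral (hcont.integrable_of_hasCompactSupport hc).norm
            (.of_forall fun _ => norm_nonneg _)

theorem iteratedFDeriv_bounded_of_hasCompactSupport_deriv {g : ℝ → ℝ} (hg : ContDiff ℝ ∞ g)
    (hc : HasCompactSupport (deriv g)) (n : ℕ) : ∃ C : ℝ, ∀ t, ‖iteratedFDeriv ℝ n g t‖ ≤ C := by
  simp_rw [norm_iteratedFDeriv_eq_norm_iteratedDeriv]
  cases n with
  | zero => simpa using bounded_of_hasCompactSupport_deriv (hg.of_le (mod_cast le_top)) hc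
  | succ n =>
    have hg' : ContDiff ℝ ∞ (deriv g) := (contDiff_infty_iff_deriv.1 hg).2
    simp_rw [iteratedDeriv_succ', ← norm_iteratedFDeriv_eq_norm_iteratedDeriv]
    exact (hg'.continuous_iteratedFDeriv (m := n)
      (mod_cast le_top)).bounded_above_of_compact_support (hc.iteratedFDeriv n)

theorem comp_linear_mem_scalarAlgebra {g : ℝ → ℝ} (hg : ContDiff ℝ ∞ g)
    (hc : HasCompactSupport (deriv g)) (hmono : Monotone g) {ℓ : Minkowski →L[ℝ] ℝ}
    (hp : 0 ≤ ℓ (1, 1)) (hm : 0 ≤ ℓ (1, -1)) :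
    (fun x => ((g (ℓ x) : ℝ) : ℂ)) ∈ scalarAlgebra := by
  refine Submodule.subset_span ⟨fun x => g (ℓ x), hg.comp ℓ.contDiff, fun n => ?_,
    isCausalFunction_comp_linear hmono hp hm, fun _ => rfl⟩
  obtain ⟨C, hC⟩ := iteratedFDeriv_bounded_of_hasCompactSupport_deriv hg hc n
  refine ⟨C * ∏ _i : Fin n, ‖ℓ‖, fun x => ?_⟩
  rw [show (fun x => g (ℓ x)) = g ∘ ℓ from rfl,
    ℓ.iteratedFDeriv_comp_right hg x (i := n) (mod_cast le_top)]
  exact (ContinuousMultilinearMap.norm_compContinuousLinearMap_le _ _).trans <|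
    mul_le_mul_of_nonneg_right (hC _) (Finset.prod_nonneg fun _ _ => norm_nonneg _)

theorem const_mem_scalarAlgebra (c : ℝ) : (fun _ => (c : ℂ)) ∈ scalarAlgebra :=
  comp_linear_mem_scalarAlgebra (g := fun _ => c) (ℓ := 0) contDiff_const
    (by rw [deriv_const']; exact HasCompactSupport.zero) monotone_const le_rfl le_rfl

/-! ### A family of elements of the causal cone -/

/-- Differential inequalities under which the Hermitian matrices with diagonal entries `A` and
off-diagonal entries `-B` form a causal element, for `δ = d₁ - d₂`. -/
structure IsCausalPair (δ : ℝ) (A B : Minkowski → ℝ) : Prop where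
  differentiable_diag : Differentiable ℝ A
  differentiable_offDiag : Differentiable ℝ B
  abs_fderiv_plus_le (x : Minkowski) : |fderiv ℝ B x (1, 1)| ≤ fderiv ℝ A x (1, 1)
  abs_fderiv_minus_le (x : Minkowski) : |fderiv ℝ B x (1, -1)| ≤ fderiv ℝ A x (1, -1)
  sq_le_sub_mul_add (x : Minkowski) :
    (δ * B x) ^ 2 ≤ (fderiv ℝ A x (1, 1) - fderiv ℝ B x (1, 1)) *
      (fderiv ℝ A x (1, -1) + fderiv ℝ B x (1, -1))
  sq_le_add_mul_sub (x : Minkowski) :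
    (δ * B x) ^ 2 ≤ (fderiv ℝ A x (1, 1) + fderiv ℝ B x (1, 1)) *
      (fderiv ℝ A x (1, -1) - fderiv ℝ B x (1, -1))

/-- The matrix `diag(k)* (α - β σ_x) diag(k)`. -/
def testMatrix (k : Fin 2 → ℂ) (α β : ℝ) : Mat2 :=
  !![α * (star (k 0) * k 0), -β * (star (k 0) * k 1);
    -β * (star (k 1) * k 0), α * (star (k 1) * k 1)]

/-- The matrix function `diag(k)* (A - B σ_x) diag(k)`. -/
def testFunction (k : Fin 2 → ℂ) (A B : Minkowski → ℝ) (x : Minkowski) : Mat2 :=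
  testMatrix k (A x) (B x)

theorem testMatrix_isHermitian (k : Fin 2 → ℂ) (α β : ℝ) : (testMatrix k α β).IsHermitian := by
  ext i j
  fin_cases i <;> fin_cases j <;> simp [testMatrix, mul_comm]

theorem dotProduct_testMatrix_mulVec (k : Fin 2 → ℂ) (α β : ℝ) (u : Fin 2 → ℂ) :
    star u ⬝ᵥ testMatrix k α β *ᵥ u =
      (α * (Complex.normSq (k 0 * u 0) + Complex.normSq (k 1 * u 1)) -
        2 * β * (star (k 0 * u 0) * (k 1 * u 1)).re : ℝ) := by
  have hre : (2 * (star (k 0 * u 0) * (k 1 * u 1)).re : ℂ) =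
      star (k 0 * u 0) * (k 1 * u 1) + star (k 1 * u 1) * (k 0 * u 0) := by
    rw [Complex.re_eq_add_conj]
    simp [mul_comm]
    ring
  rw [mul_right_comm]
  push_cast
  rw [hre, Complex.normSq_eq_conj_mul_self, Complex.normSq_eq_conj_mul_self]
  simp [testMatrix, Matrix.mulVec, dotProduct, Fin.sum_univ_two]
  ring

theorem dotProduct_commutator_testMatrix_mulVec (d₁ d₂ : ℝ) (k : Fin 2 → ℂ) (α β : ℝ)
    (u w : Fin 2 → ℂ) :
    star u ⬝ᵥ ⁅finiteDirac d₁ d₂, testMatrix k α β⁆ *ᵥ w -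
        star w ⬝ᵥ ⁅finiteDirac d₁ d₂, testMatrix k α β⁆ *ᵥ u =
      (-2 * ((d₁ - d₂) * β) *
        (star (k 0 * u 0) * (k 1 * w 1) - star (k 1 * u 1) * (k 0 * w 0)).re : ℝ) := by
  rw [mul_right_comm]
  push_cast
  rw [Complex.re_eq_add_conj]
  simp [testMatrix, finiteDirac, Ring.lie_def, Matrix.mulVec, dotProduct, Fin.sum_univ_two,
    Matrix.vecMul_diagonal]
  ring

theorem binary_quadratic_nonneg {α β m : ℝ} (hα : 0 ≤ α) (hβ : 0 ≤ β) (h : m ^ 2 ≤ α * β)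
    (s t : ℝ) : 0 ≤ α * s ^ 2 + β * t ^ 2 + 2 * m * (s * t) := by
  rcases hα.eq_or_lt with rfl | hα'
  · have hm : m = 0 := by nlinarith
    rw [hm]
    nlinarith [mul_nonneg hβ (sq_nonneg t)]
  · have hsq : α * (α * s ^ 2 + β * t ^ 2 + 2 * m * (s * t)) =
        (α * s + m * t) ^ 2 + (α * β - m ^ 2) * t ^ 2 := by ring
    exact nonneg_of_mul_nonneg_right (hsq ▸ by have := sub_nonneg.2 h; positivity) hα'

theorem spinor_form_nonneg {P Q p q m : ℝ} (hP : |p| ≤ P) (hQ : |q| ≤ Q)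
    (hm : m ^ 2 ≤ (P - p) * (Q + q)) (hm' : m ^ 2 ≤ (P + p) * (Q - q)) (X₁ X₂ Y₁ Y₂ : ℂ) :
    0 ≤ (P * (Complex.normSq X₁ + Complex.normSq X₂) - 2 * p * (star X₁ * X₂).re) +
      (Q * (Complex.normSq Y₁ + Complex.normSq Y₂) - 2 * q * (star Y₁ * Y₂).re) +
      -2 * m * (star X₁ * Y₂ - star X₂ * Y₁).re := by
  obtain ⟨hP₁, hP₂⟩ := abs_le.1 hP
  obtain ⟨hQ₁, hQ₂⟩ := abs_le.1 hQ
  have hsub : 0 ≤ P - p ∧ 0 ≤ Q - q := ⟨by linarith, by linarith⟩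
  have hadd : 0 ≤ P + p ∧ 0 ≤ Q + q := ⟨by linarith, by linarith⟩
  have hmul := binary_quadratic_nonneg hsub.1 hadd.2 hm
  have hmul' := binary_quadratic_nonneg (m := -m) hadd.1 hsub.2 (by rwa [neg_sq])
  -- the form decouples into the components `X₁ ± X₂` and `Y₁ ∓ Y₂`
  have hre := hmul (X₁ + X₂).re (Y₁ - Y₂).re
  have him := hmul (X₁ + X₂).im (Y₁ - Y₂).im
  have hre' := hmul' (X₁ - X₂).re (Y₁ + Y₂).re
  have him' := hmul' (X₁ - X₂).im (Y₁ + Y₂).im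
  simp only [Complex.normSq_apply, Complex.mul_re, Complex.add_re, Complex.sub_re, Complex.add_im,
    Complex.sub_im, Complex.star_def, Complex.conj_re, Complex.conj_im] at hre him hre' him' ⊢
  linarith

theorem testFunction_mem_algebra {A B : Minkowski → ℝ}
    (hA : (fun x => (A x : ℂ)) ∈ scalarAlgebra) (hB : ContDiff ℝ ∞ B) (hBc : HasCompactSupport B)
    (k : Fin 2 → ℂ) : testFunction k A B ∈ algebra := by
  have hBc' : HasCompactSupport fun x => (B x : ℂ) := hBc.comp_left Complex.ofReal_zero
  let S : 𝓢(Minkowski, ℂ) := hBc'.toSchwartzMap (Complex.ofRealCLM.contDiff.comp hB)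
  have hS (x : Minkowski) : S x = B x := rfl
  refine ⟨fun i => ?_, fun i j hij => ⟨(-(star (k i) * k j)) • S, fun x => ?_⟩⟩
  · convert scalarAlgebra.smul_mem (star (k i) * k i) hA using 1
    ext x
    fin_cases i <;> simp [testFunction, testMatrix, mul_comm]
  · fin_cases i <;> fin_cases j <;>
      first | exact absurd rfl hij | simp [testFunction, testMatrix, hS, mul_comm]

theorem fderiv_testFunction {A B : Minkowski → ℝ} (k : Fin 2 → ℂ)
    (ht : testFunction k A B ∈ algebra) {x : Minkowski} (hA : DifferentiableAt ℝ A x)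
    (hB : DifferentiableAt ℝ B x) (v : Minkowski) :
    fderiv ℝ (testFunction k A B) x v = testMatrix k (fderiv ℝ A x v) (fderiv ℝ B x v) := by
  have hA' : HasFDerivAt (fun y => (A y : ℂ)) _ x :=
    Complex.ofRealCLM.hasFDerivAt.comp x hA.hasFDerivAt
  have hB' : HasFDerivAt (fun y => (B y : ℂ)) _ x :=
    Complex.ofRealCLM.hasFDerivAt.comp x hB.hasFDerivAt
  have hdiag (c : ℂ) : fderiv ℝ (fun y => A y * c) x v = fderiv ℝ A x v * c := by
    rw [(hA'.mul_const c).fderiv]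
    simp [mul_comm]
  have hoff (c : ℂ) : fderiv ℝ (fun y => -B y * c) x v = -fderiv ℝ B x v * c := by
    rw [(hB'.fun_neg.mul_const c).fderiv]
    simp [mul_comm]
  ext i j
  rw [← fderiv_matrix_entry (algebra_differentiable ht x)]
  fin_cases i <;> fin_cases j
  exacts [hdiag _, hoff _, hoff _, hdiag _]

theorem IsCausalPair.testFunction_mem_causalCone {d₁ d₂ : ℝ} {A B : Minkowski → ℝ}
    (h : IsCausalPair (d₁ - d₂) A B) {k : Fin 2 → ℂ} (ht : testFunction k A B ∈ algebra) :
    ⟨testFunction k A B, ht⟩ ∈ causalCone d₁ d₂ := by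
  refine mem_causalCone (fun x => testMatrix_isHermitian k _ _) fun x ξ => ?_
  have hξ : ξ = WithLp.toLp 2 fun j => ![fun i => ξ (0, i), fun i => ξ (1, i)] j.1 j.2 := by
    ext ⟨i, j⟩
    fin_cases i <;> rfl
  have hform := spinor_form_nonneg (h.abs_fderiv_plus_le x) (h.abs_fderiv_minus_le x)
    (h.sq_le_sub_mul_add x) (h.sq_le_add_mul_sub x)
    (k 0 * ξ (0, 0)) (k 1 * ξ (0, 1)) (k 0 * ξ (1, 0)) (k 1 * ξ (1, 1))
  have hderiv := fderiv_testFunction k ht (h.differentiable_diag x) (h.differentiable_offDiag x)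
  rw [hξ, causalForm_eq, hderiv, hderiv]
  simp only [testFunction, dotProduct_testMatrix_mulVec, dotProduct_commutator_testMatrix_mulVec]
  rw [← Complex.ofReal_neg, ← Complex.ofReal_sub, ← Complex.ofReal_sub, ← Complex.ofReal_zero,
    Complex.real_le_real]
  linarith

theorem IsCausalPair.zero_right {A : Minkowski → ℝ} (hA : Differentiable ℝ A)
    (hp : ∀ x, 0 ≤ fderiv ℝ A x (1, 1)) (hm : ∀ x, 0 ≤ fderiv ℝ A x (1, -1)) (δ : ℝ) :
    IsCausalPair δ A 0 where
  differentiable_diag := hA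
  differentiable_offDiag := differentiable_const 0
  abs_fderiv_plus_le x := by simpa using hp x
  abs_fderiv_minus_le x := by simpa using hm x
  sq_le_sub_mul_add x := by simpa using mul_nonneg (hp x) (hm x)
  sq_le_add_mul_sub x := by simpa using mul_nonneg (hp x) (hm x)

theorem blochValue_testMatrix (k : Fin 2 → ℂ) (α β z : ℝ) (c : ℂ) :
    blochValue (testMatrix k α β) z c =
      ((1 + z) / 2 * Complex.normSq (k 0) + (1 - z) / 2 * Complex.normSq (k 1)) * α -
        β * (c * (star (k 0) * k 1)).re := by
  rw [← Complex.re_ofReal_mul, ← Complex.ofReal_re (_ * α), ← Complex.sub_re, blochValue]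
  congr 1
  push_cast
  rw [Complex.normSq_eq_conj_mul_self, Complex.normSq_eq_conj_mul_self]
  simp [testMatrix]
  ring

/-! ### Conditions on the base points -/

/-- The causal relation between the states at `p` and `q` whose Bloch vectors have third
coordinates `z` and `z'`, the first two coordinates being gathered in `c` and `c'`. -/
def BlochPrecedes (d₁ d₂ : ℝ) (p : Minkowski) (z : ℝ) (c : ℂ) (q : Minkowski) (z' : ℝ) (c' : ℂ) :
    Prop :=
  ∀ a ∈ causalCone d₁ d₂, blochValue (a.1 p) z c ≤ blochValue (a.1 q) z' c'

section BlochPrecedes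

variable {d₁ d₂ : ℝ} {p q : Minkowski} {z z' : ℝ} {c c' : ℂ}

theorem BlochPrecedes.testMatrix_le (h : BlochPrecedes d₁ d₂ p z c q z' c') {A B : Minkowski → ℝ}
    (hAB : IsCausalPair (d₁ - d₂) A B) (hA : (fun x => (A x : ℂ)) ∈ scalarAlgebra)
    (hB : ContDiff ℝ ∞ B) (hBc : HasCompactSupport B) (k : Fin 2 → ℂ) :
    blochValue (testMatrix k (A p) (B p)) z c ≤ blochValue (testMatrix k (A q) (B q)) z' c' :=
  h _ (hAB.testFunction_mem_causalCone (testFunction_mem_algebra hA hB hBc k))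

theorem BlochPrecedes.diag_le (h : BlochPrecedes d₁ d₂ p z c q z' c') {A : Minkowski → ℝ}
    (hA : (fun x => (A x : ℂ)) ∈ scalarAlgebra) (hAd : Differentiable ℝ A)
    (hp : ∀ x, 0 ≤ fderiv ℝ A x (1, 1)) (hm : ∀ x, 0 ≤ fderiv ℝ A x (1, -1)) (k : Fin 2 → ℂ) :
    ((1 + z) / 2 * Complex.normSq (k 0) + (1 - z) / 2 * Complex.normSq (k 1)) * A p ≤
      ((1 + z') / 2 * Complex.normSq (k 0) + (1 - z') / 2 * Complex.normSq (k 1)) * A q := by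
  have := h.testMatrix_le (.zero_right hAd hp hm _) hA contDiff_const HasCompactSupport.zero k
  simpa only [blochValue_testMatrix, Pi.zero_apply, zero_mul, sub_zero] using this

theorem BlochPrecedes.eq (h : BlochPrecedes d₁ d₂ p z c q z' c') : z = z' := by
  have hconst (m : ℝ) : (1 + z) / 2 * m ≤ (1 + z') / 2 * m := by
    simpa using h.diag_le (const_mem_scalarAlgebra m) (differentiable_const m)
      (fun x => by simp) (fun x => by simp) ![1, 0]
  linarith [hconst 1, hconst (-1)]

theorem exists_smooth_cutoff {E : Type*} [NormedAddCommGroup E] [NormedSpace ℝ E]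
    [FiniteDimensional ℝ E] {K U : Set E} (hK : IsCompact K) (hU : IsOpen U) (hKU : K ⊆ U) :
    ∃ χ : E → ℝ, ContDiff ℝ ∞ χ ∧ HasCompactSupport χ ∧ tsupport χ ⊆ U ∧
      (∀ t, χ t ∈ Set.Icc 0 1) ∧ ∀ᶠ t in 𝓝ˢ K, χ t = 1 := by
  obtain ⟨L, hL, hKL, hLU⟩ := exists_compact_between hK hU hKU
  obtain ⟨χ, hone, hzero, hχ⟩ := exists_contMDiffMap_one_nhds_of_subset_interior (n := ⊤)
    (modelWithCornersSelf ℝ E) hK.isClosed hKL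
  exact ⟨χ, χ.contMDiff.contDiff, .intro hL hzero,
    (closure_minimal (Function.support_subset_iff'.2 hzero) hL.isClosed).trans hLU, hχ, hone⟩

theorem exists_contDiff_deriv_eq {g : ℝ → ℝ} (hg : ContDiff ℝ ∞ g) :
    ∃ G : ℝ → ℝ, ContDiff ℝ ∞ G ∧ deriv G = g := by
  have hG (t : ℝ) : HasDerivAt (fun t => ∫ u in (0 : ℝ)..t, g u) (g t) t :=
    (hg.continuous.integral_hasStrictDerivAt 0 t).hasDerivAt
  have hG' : deriv (fun t => ∫ u in (0 : ℝ)..t, g u) = g := funext fun t => (hG t).deriv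
  exact ⟨_, contDiff_infty_iff_deriv.2 ⟨fun t => (hG t).differentiableAt, hG'.symm ▸ hg⟩, hG'⟩

theorem fderiv_comp_continuousLinearMap {g : ℝ → ℝ} (hg : Differentiable ℝ g)
    (ℓ : Minkowski →L[ℝ] ℝ) (x v : Minkowski) :
    fderiv ℝ (fun x => g (ℓ x)) x v = deriv g (ℓ x) * ℓ v := by
  have h : HasFDerivAt (fun x => g (ℓ x)) (deriv g (ℓ x) • ℓ) x :=
    (hg (ℓ x)).hasDerivAt.comp_hasFDerivAt x ℓ.hasFDerivAt
  rw [h.fderiv]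
  rfl

theorem BlochPrecedes.map_le (h : BlochPrecedes d₁ d₂ p z c q z' c') {ℓ : Minkowski →L[ℝ] ℝ}
    (hp : 0 ≤ ℓ (1, 1)) (hm : 0 ≤ ℓ (1, -1)) : ℓ p ≤ ℓ q := by
  by_contra! hlt
  obtain ⟨χ, hχ, hχc, -, hχ01, hχK⟩ :=
    exists_smooth_cutoff (isCompact_Icc (a := ℓ q) (b := ℓ p)) isOpen_univ (Set.subset_univ _)
  obtain ⟨G, hG, rfl⟩ := exists_contDiff_deriv_eq hχ
  have hGd : Differentiable ℝ G := hG.differentiable (by simp)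
  have hderiv := fderiv_comp_continuousLinearMap hGd ℓ
  have hle := h.diag_le
    (comp_linear_mem_scalarAlgebra hG hχc
      (monotone_of_deriv_nonneg hGd fun t => (hχ01 t).1) hp hm)
    (hGd.comp ℓ.differentiable)
    (fun x => (hderiv x _).symm ▸ mul_nonneg (hχ01 _).1 hp)
    (fun x => (hderiv x _).symm ▸ mul_nonneg (hχ01 _).1 hm) ![1, 1]
  have hstrict : StrictMonoOn G (Set.Icc (ℓ q) (ℓ p)) :=
    strictMonoOn_of_deriv_pos (convex_Icc _ _) hG.continuous.continuousOn fun t ht => by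
      rw [hχK.self_of_nhdsSet t (interior_subset ht)]
      exact one_pos
  have := hstrict (Set.left_mem_Icc.2 hlt.le) (Set.right_mem_Icc.2 hlt.le) hlt
  simp at hle
  linarith

theorem BlochPrecedes.abs_snd_le (h : BlochPrecedes d₁ d₂ p z c q z' c') :
    |(q - p).2| ≤ (q - p).1 := by
  have hadd := h.map_le (ℓ := .fst ℝ ℝ ℝ + .snd ℝ ℝ ℝ) (by simp) (by simp)
  have hsub := h.map_le (ℓ := .fst ℝ ℝ ℝ - .snd ℝ ℝ ℝ) (by simp) (by simp)
  simp only [add_apply, sub_apply, ContinuousLinearMap.coe_fst', ContinuousLinearMap.coe_snd']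
    at hadd hsub
  rw [abs_le, Prod.fst_sub, Prod.snd_sub]
  constructor <;> linarith

end BlochPrecedes

/-! ### Profiles of the extremal elements of the causal cone -/

theorem exists_contDiff_eventuallyEq {E : Type*} [NormedAddCommGroup E] [NormedSpace ℝ E]
    [FiniteDimensional ℝ E] {f : E → ℝ} {K U : Set E} (hK : IsCompact K) (hU : IsOpen U)
    (hKU : K ⊆ U) (hf : ContDiffOn ℝ ∞ f U) :
    ∃ b : E → ℝ, ContDiff ℝ ∞ b ∧ HasCompactSupport b ∧ b =ᶠ[𝓝ˢ K] f := by
  obtain ⟨χ, hχ, hχc, hχU, -, hχK⟩ := exists_smooth_cutoff hK hU hKU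
  refine ⟨fun t => χ t * f t, ?_, hχc.mul_right, hχK.mono fun t ht => by simp only [ht, one_mul]⟩
  refine contMDiff_iff_contDiff.1 (contMDiff_of_tsupport fun t ht => ?_)
  have htU : t ∈ U := hχU (tsupport_mul_subset_left ht)
  exact (hχ.contDiffAt.mul (hf.contDiffAt (hU.mem_nhds htU))).contMDiffAt

theorem eventually_mul_lt (a : ℝ) {b : ℝ} (hb : 0 < b) : ∀ᶠ c in 𝓝[>] (0 : ℝ), c * a < b :=
  (((continuous_id.mul continuous_const).tendsto' 0 0 (zero_mul a)).eventually_lt_const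
    hb).filter_mono nhdsWithin_le_nhds

theorem exists_slow_cutoff {ε : ℝ} (hε : 0 < ε) (R : ℝ) :
    ∃ χ : ℝ → ℝ, ContDiff ℝ ∞ χ ∧ HasCompactSupport χ ∧ (∀ s, χ s ∈ Set.Icc 0 1) ∧
      (∀ s, |deriv χ s| ≤ ε) ∧ ∀ s, |s| ≤ R → χ s = 1 := by
  obtain ⟨f, hf, hfc, -, hf01, hf1⟩ := exists_smooth_cutoff
    (isCompact_Icc (a := (-1 : ℝ)) (b := 1)) isOpen_univ (Set.subset_univ _)
  obtain ⟨K, hK⟩ := (hf.continuous_deriv (by simp)).bounded_above_of_compact_support hfc.deriv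
  obtain ⟨c, ⟨hcK, hcR⟩, hc⟩ := (((eventually_mul_lt K hε).and
    (eventually_mul_lt R one_pos)).and self_mem_nhdsWithin).exists
  refine ⟨fun s => f (c • s), hf.comp (contDiff_const_smul c), hfc.comp_smul hc.ne',
    fun s => hf01 (c • s), fun s => ?_, fun s hs => ?_⟩
  · simp only [smul_eq_mul, deriv_comp_mul_left, abs_mul, abs_of_pos hc]
    exact (mul_le_mul_of_nonneg_left (hK _) hc.le).trans hcK.le
  · refine hf1.self_of_nhdsSet _ (abs_le.1 ?_)
    rw [smul_eq_mul, abs_mul, abs_of_pos hc]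
    exact (mul_le_mul_of_nonneg_left hs hc.le).trans hcR.le

theorem exists_dominating_primitive {b : ℝ → ℝ} (hb : ContDiff ℝ ∞ b) (hbc : HasCompactSupport b)
    (D : ℝ) {η : ℝ} (hη : 0 < η) :
    ∃ (G : ℝ → ℝ) (ε : ℝ), 0 < ε ∧ ContDiff ℝ ∞ G ∧ HasCompactSupport (deriv G) ∧
      (∀ t, √(deriv b t ^ 2 + D ^ 2 * b t ^ 2) + ε * |b t| ≤ deriv G t) ∧
      ∀ t, deriv G t ≤ √(deriv b t ^ 2 + D ^ 2 * b t ^ 2) + 2 * η := by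
  obtain ⟨φ, hφ, hφc, -, hφ01, hφb⟩ :=
    exists_smooth_cutoff hbc.isCompact isOpen_univ (Set.subset_univ _)
  obtain ⟨K, hK⟩ := hb.continuous.bounded_above_of_compact_support hbc
  obtain ⟨ε, hεK, hε : 0 < ε⟩ := ((eventually_mul_lt K hη).and self_mem_nhdsWithin).exists
  have hb' : ContDiff ℝ ∞ (deriv b) := (contDiff_infty_iff_deriv.1 hb).2
  -- the summand `η ^ 2` makes the square root smooth
  have hroot : ContDiff ℝ ∞ fun t => √(deriv b t ^ 2 + D ^ 2 * b t ^ 2 + η ^ 2) :=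
    (((hb'.pow 2).add (contDiff_const.mul (hb.pow 2))).add contDiff_const).sqrt
      fun t => by positivity
  obtain ⟨G, hG, hG'⟩ := exists_contDiff_deriv_eq (hφ.mul (hroot.add (contDiff_const (c := η))))
  refine ⟨G, ε, hε, hG, hG' ▸ hφc.mul_right, fun t => ?_, fun t => ?_⟩
  · rw [hG']
    by_cases ht : t ∈ tsupport b
    · simp only [hφb.self_of_nhdsSet t ht, one_mul]
      have hεb : ε * |b t| ≤ η := (mul_le_mul_of_nonneg_left (hK t) hε.le).trans hεK.le
      exact add_le_add (Real.sqrt_le_sqrt (le_add_of_nonneg_right (sq_nonneg η))) hεb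
    · have hb't : deriv b t = 0 := by_contra fun h => ht (support_deriv_subset h)
      simp only [image_eq_zero_of_notMem_tsupport ht, hb't]
      have := (hφ01 t).1
      simpa using by positivity
  · rw [hG']
    refine (mul_le_of_le_one_left (by positivity) (hφ01 t).2).trans ?_
    have hsqrt : √(deriv b t ^ 2 + D ^ 2 * b t ^ 2 + η ^ 2) ≤
        √(deriv b t ^ 2 + D ^ 2 * b t ^ 2) + η := by
      refine Real.sqrt_le_iff.2 ⟨by positivity, ?_⟩
      rw [add_sq, Real.sq_sqrt (by positivity)]
      have : 0 ≤ √(deriv b t ^ 2 + D ^ 2 * b t ^ 2) := Real.sqrt_nonneg _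
      nlinarith
    linarith

theorem hasDerivAt_inv_sin_sub_mul (β D : ℝ) {t : ℝ} (hS : Real.sin (β - D * t) ≠ 0) :
    HasDerivAt (fun t => (Real.sin (β - D * t))⁻¹)
      (D * Real.cos (β - D * t) / Real.sin (β - D * t) ^ 2) t := by
  have hlin : HasDerivAt (fun t => β - D * t) (-D) t := by
    simpa using ((hasDerivAt_id t).const_mul D).const_sub β
  exact (hlin.sin.fun_inv hS).congr_deriv (by ring)

theorem hasDerivAt_cot_sub_mul (β D : ℝ) {t : ℝ} (hS : Real.sin (β - D * t) ≠ 0) :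
    HasDerivAt (fun t => Real.cos (β - D * t) / Real.sin (β - D * t))
      (D / Real.sin (β - D * t) ^ 2) t := by
  have hlin : HasDerivAt (fun t => β - D * t) (-D) t := by
    simpa using ((hasDerivAt_id t).const_mul D).const_sub β
  refine (hlin.cos.fun_div hlin.sin hS).congr_deriv ?_
  congr 1
  linear_combination D * Real.sin_sq_add_cos_sq (β - D * t)

theorem sqrt_deriv_inv_sin {θ D : ℝ} (hθ : Real.sin θ ≠ 0) (hD : 0 ≤ D) :
    √((D * Real.cos θ / Real.sin θ ^ 2) ^ 2 + D ^ 2 * (Real.sin θ)⁻¹ ^ 2) =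
      D / Real.sin θ ^ 2 := by
  rw [← Real.sqrt_sq (show 0 ≤ D / Real.sin θ ^ 2 by positivity)]
  congr 1
  field_simp
  linear_combination D ^ 2 * Real.sin_sq_add_cos_sq θ

theorem exists_inv_sin_profile {D t₀ t₁ β : ℝ} (hD : 0 ≤ D) (h₁ : 0 < β - D * t₁)
    (h₀ : β - D * t₀ < Real.pi) :
    ∃ b : ℝ → ℝ, ContDiff ℝ ∞ b ∧ HasCompactSupport b ∧ ∀ t ∈ Set.Icc t₀ t₁,
      Real.sin (β - D * t) ≠ 0 ∧ b t = (Real.sin (β - D * t))⁻¹ ∧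
        deriv b t = D * Real.cos (β - D * t) / Real.sin (β - D * t) ^ 2 := by
  have hU : IsOpen {t | Real.sin (β - D * t) ≠ 0} := isOpen_ne_fun (by fun_prop) continuous_const
  have hsin (t : ℝ) (ht : t ∈ Set.Icc t₀ t₁) : Real.sin (β - D * t) ≠ 0 := by
    have := mul_le_mul_of_nonneg_left ht.1 hD
    have := mul_le_mul_of_nonneg_left ht.2 hD
    exact (Real.sin_pos_of_pos_of_lt_pi (by linarith) (by linarith)).ne'
  obtain ⟨b, hb, hbc, hbsin⟩ := exists_contDiff_eventuallyEq isCompact_Icc hU hsin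
    (f := fun t => (Real.sin (β - D * t))⁻¹) (.inv (by fun_prop) fun _ => id)
  refine ⟨b, hb, hbc, fun t ht => ⟨hsin t ht, hbsin.self_of_nhdsSet ht, ?_⟩⟩
  have hnhds : b =ᶠ[𝓝 t] _ := eventually_nhdsSet_iff_forall.1 hbsin t ht
  rw [hnhds.deriv_eq, (hasDerivAt_inv_sin_sub_mul β D (hsin t ht)).deriv]

theorem exists_profile {D t₀ t₁ β δ : ℝ} (hD : 0 ≤ D) (ht : t₀ ≤ t₁) (h₁ : 0 < β - D * t₁)
    (h₀ : β - D * t₀ < Real.pi) (hδ : 0 < δ) :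
    ∃ (b G : ℝ → ℝ) (ε : ℝ), 0 < ε ∧ ContDiff ℝ ∞ b ∧ HasCompactSupport b ∧ ContDiff ℝ ∞ G ∧
      HasCompactSupport (deriv G) ∧
      (∀ t, √(deriv b t ^ 2 + D ^ 2 * b t ^ 2) + ε * |b t| ≤ deriv G t) ∧
      b t₀ = (Real.sin (β - D * t₀))⁻¹ ∧ b t₁ = (Real.sin (β - D * t₁))⁻¹ ∧
      G t₁ - G t₀ ≤ Real.cos (β - D * t₁) / Real.sin (β - D * t₁) -
        Real.cos (β - D * t₀) / Real.sin (β - D * t₀) + δ := by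
  obtain ⟨b, hb, hbc, hbsin⟩ := exists_inv_sin_profile hD h₁ h₀
  obtain ⟨η, hηδ, hη⟩ := ((eventually_mul_lt (2 * (t₁ - t₀)) hδ).and self_mem_nhdsWithin).exists
  obtain ⟨G, ε, hε, hG, hGc, hGb, hGη⟩ := exists_dominating_primitive hb hbc D hη
  have hleft := Set.left_mem_Icc.2 ht
  have hright := Set.right_mem_Icc.2 ht
  refine ⟨b, G, ε, hε, hb, hbc, hG, hGc, hGb, (hbsin t₀ hleft).2.1, (hbsin t₁ hright).2.1, ?_⟩
  have hderiv (t : ℝ) (htm : t ∈ Set.Icc t₀ t₁) :=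
    (hG.differentiable (by simp) t).hasDerivAt.sub (hasDerivAt_cot_sub_mul β D (hbsin t htm).1)
  have hslope (t : ℝ) (htm : t ∈ Set.Icc t₀ t₁) :
      deriv G t - D / Real.sin (β - D * t) ^ 2 ≤ 2 * η := by
    obtain ⟨hsin, hbt, hb't⟩ := hbsin t htm
    have hGt := hGη t
    rw [hb't, hbt, sqrt_deriv_inv_sin hsin hD] at hGt
    linarith
  have hmean := (convex_Icc t₀ t₁).image_sub_le_mul_sub_of_deriv_le (C := 2 * η)
    (fun t htm => (hderiv t htm).continuousAt.continuousWithinAt)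
    (fun t htm => (hderiv t (interior_subset htm)).differentiableAt.differentiableWithinAt)
    (fun t htm => (hderiv t (interior_subset htm)).deriv.trans_le
      (hslope t (interior_subset htm))) t₀ hleft t₁ hright ht
  simp only [Pi.sub_apply] at hmean
  linarith

/-! ### Boosts and the arccosine bound -/

theorem profile_inequality {δ ε b b' g χ χ' : ℝ} (hg : √(b' ^ 2 + δ ^ 2 * b ^ 2) + ε * |b| ≤ g)
    (hχ : χ ∈ Set.Icc 0 1) (hχε : |χ'| ≤ ε) :
    |b' * χ| + |b * χ'| ≤ g ∧ (δ * (b * χ)) ^ 2 ≤ (g - b * χ') ^ 2 - (b' * χ) ^ 2 := by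
  have hdrift : |b * χ'| ≤ ε * |b| := by
    rw [abs_mul, mul_comm]
    exact mul_le_mul_of_nonneg_right hχε (abs_nonneg b)
  have hb' : |b'| ≤ √(b' ^ 2 + δ ^ 2 * b ^ 2) := Real.abs_le_sqrt (by nlinarith [sq_nonneg (δ * b)])
  have hroot : √(b' ^ 2 + δ ^ 2 * b ^ 2) * χ ≤ g - |b * χ'| :=
    (mul_le_of_le_one_right (Real.sqrt_nonneg _) hχ.2).trans (by linarith)
  constructor
  · rw [abs_mul, abs_of_nonneg hχ.1]
    linarith [mul_le_mul_of_nonneg_right hb' hχ.1]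
  · have hsq := pow_le_pow_left₀ (mul_nonneg (Real.sqrt_nonneg _) hχ.1)
      (hroot.trans (sub_le_sub_left (le_abs_self _) g)) 2
    rw [mul_pow, Real.sq_sqrt (by positivity)] at hsq
    linarith

theorem isCausalPair_of_profile {δ ε : ℝ} {b G χ : ℝ → ℝ} (hb : Differentiable ℝ b)
    (hG : Differentiable ℝ G) (hχ : Differentiable ℝ χ)
    (hGb : ∀ t, √(deriv b t ^ 2 + δ ^ 2 * b t ^ 2) + ε * |b t| ≤ deriv G t)
    (hχ01 : ∀ s, χ s ∈ Set.Icc 0 1) (hχε : ∀ s, |deriv χ s| ≤ ε) :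
    IsCausalPair δ (fun y => G y.1) (fun y => b y.1 * χ y.2) := by
  have hA (y v : Minkowski) : fderiv ℝ (fun y : Minkowski => G y.1) y v = deriv G y.1 * v.1 :=
    fderiv_comp_continuousLinearMap hG (.fst ℝ ℝ ℝ) y v
  have hb₁ (y : Minkowski) :=
    (hb y.1).hasDerivAt.comp_hasFDerivAt y (ContinuousLinearMap.fst ℝ ℝ ℝ).hasFDerivAt
  have hχ₂ (y : Minkowski) :=
    (hχ y.2).hasDerivAt.comp_hasFDerivAt y (ContinuousLinearMap.snd ℝ ℝ ℝ).hasFDerivAt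
  have hB (y v : Minkowski) : fderiv ℝ (fun y : Minkowski => b y.1 * χ y.2) y v =
      deriv b y.1 * χ y.2 * v.1 + b y.1 * deriv χ y.2 * v.2 := by
    have h : fderiv ℝ (fun y : Minkowski => b y.1 * χ y.2) y = _ := ((hb₁ y).mul (hχ₂ y)).fderiv
    rw [h]
    simp
    ring
  have hprofile (y : Minkowski) := profile_inequality (hGb y.1) (hχ01 y.2) (hχε y.2)
  have hprofile' (y : Minkowski) :=
    profile_inequality (hGb y.1) (hχ01 y.2) ((abs_neg _).trans_le (hχε y.2))
  refine ⟨fun y => ((hG y.1).hasDerivAt.comp_hasFDerivAt y hasFDerivAt_fst).differentiableAt,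
    fun y => ((hb₁ y).mul (hχ₂ y)).differentiableAt, fun y => ?_, fun y => ?_, fun y => ?_,
    fun y => ?_⟩ <;> simp only [hA, hB, mul_one, mul_neg]
  · exact (abs_add_le _ _).trans (hprofile y).1
  · exact (abs_add_le _ _).trans (abs_neg (b y.1 * deriv χ y.2) ▸ (hprofile y).1)
  · exact (hprofile y).2.trans_eq (by ring)
  · exact (hprofile' y).2.trans_eq (by ring)

/-- The Lorentz boost of rapidity `η`. -/
def boost (η : ℝ) : Minkowski ≃L[ℝ] Minkowski :=
  LinearEquiv.toContinuousLinearEquiv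
    { toFun := fun x =>
        (Real.cosh η * x.1 + Real.sinh η * x.2, Real.sinh η * x.1 + Real.cosh η * x.2)
      invFun := fun x =>
        (Real.cosh η * x.1 - Real.sinh η * x.2, -Real.sinh η * x.1 + Real.cosh η * x.2)
      map_add' := fun x y => by ext <;> simp <;> ring
      map_smul' := fun k x => by ext <;> simp <;> ring
      left_inv := fun x => by
        ext
        · linear_combination x.1 * Real.cosh_sq_sub_sinh_sq η
        · linear_combination x.2 * Real.cosh_sq_sub_sinh_sq η
      right_inv := fun x => by
        ext
        · linear_combination x.1 * Real.cosh_sq_sub_sinh_sq η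
        · linear_combination x.2 * Real.cosh_sq_sub_sinh_sq η }

theorem boost_apply (η : ℝ) (x : Minkowski) : boost η x =
    (Real.cosh η * x.1 + Real.sinh η * x.2, Real.sinh η * x.1 + Real.cosh η * x.2) := rfl

theorem boost_one_one (η : ℝ) : boost η (1, 1) = Real.exp η • ((1, 1) : Minkowski) := by
  simp [boost_apply, Real.cosh_add_sinh, Real.sinh_add_cosh]

theorem boost_one_neg_one (η : ℝ) : boost η (1, -1) = Real.exp (-η) • ((1, -1) : Minkowski) := by
  ext <;> simp [boost_apply, ← sub_eq_add_neg]

theorem IsCausalPair.comp_boost {δ : ℝ} {A B : Minkowski → ℝ} (h : IsCausalPair δ A B) (η : ℝ) :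
    IsCausalPair δ (A ∘ boost η) (B ∘ boost η) := by
  have hfderiv (f : Minkowski → ℝ) (x v : Minkowski) :
      fderiv ℝ (f ∘ boost η) x v = fderiv ℝ f (boost η x) (boost η v) := by
    rw [(boost η).comp_right_fderiv]
    rfl
  refine ⟨h.differentiable_diag.comp (boost η).differentiable,
    h.differentiable_offDiag.comp (boost η).differentiable, fun x => ?_, fun x => ?_,
    fun x => ?_, fun x => ?_⟩ <;>
    simp only [hfderiv, boost_one_one, boost_one_neg_one, map_smul, smul_eq_mul, ← mul_sub,
      ← mul_add, mul_mul_mul_comm _ _ (Real.exp (-η)), ← Real.exp_add, add_neg_cancel,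
      Real.exp_zero, one_mul, abs_mul, Real.abs_exp, Function.comp_apply]
  · exact mul_le_mul_of_nonneg_left (h.abs_fderiv_plus_le _) (Real.exp_nonneg _)
  · exact mul_le_mul_of_nonneg_left (h.abs_fderiv_minus_le _) (Real.exp_nonneg _)
  · exact h.sq_le_sub_mul_add _
  · exact h.sq_le_add_mul_sub _

theorem exists_boost_fst_eq {v : Minkowski} (hv : |v.2| < v.1) :
    ∃ η, (boost η v).1 = √(-metric v v) := by
  have hpos : 0 < v.1 := (abs_nonneg _).trans_lt hv
  have hx : -v.2 / v.1 ∈ Set.Ioo (-1) 1 := by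
    rw [Set.mem_Ioo, ← abs_lt, abs_div, abs_neg, abs_of_pos hpos]
    exact (div_lt_one hpos).2 hv
  have hsqrt : √(1 - (-v.2 / v.1) ^ 2) = √(-metric v v) / v.1 := by
    rw [← Real.sqrt_sq hpos.le, ← Real.sqrt_div' _ (sq_nonneg _), Real.sqrt_sq hpos.le, metric]
    congr 1
    field_simp
    ring
  have hmetric : 0 < -metric v v := by
    rw [neg_metric_self]
    exact mul_pos (by linarith [neg_lt_of_abs_lt hv]) (by linarith [lt_of_abs_lt hv])
  have hroot : √(-metric v v) ≠ 0 := (Real.sqrt_pos.2 hmetric).ne'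
  refine ⟨Real.artanh (-v.2 / v.1), ?_⟩
  rw [boost_apply, Real.cosh_artanh hx, Real.sinh_artanh hx, hsqrt]
  field_simp
  rw [Real.sq_sqrt hmetric.le, metric]
  ring

theorem exists_boost_mul_fst_lt {D K : ℝ} {v : Minkowski} (hD : 0 ≤ D) (hv : |v.2| ≤ v.1)
    (h : D * √(-metric v v) < K) : ∃ η, D * (boost η v).1 < K := by
  have hcont : Continuous fun ε : ℝ => D * √(-metric (v + (ε, 0)) (v + (ε, 0))) := by
    unfold metric
    fun_prop
  have hnear : ∀ᶠ ε in 𝓝[>] (0 : ℝ), D * √(-metric (v + (ε, 0)) (v + (ε, 0))) < K :=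
    ((hcont.tendsto 0).eventually_lt_const
      (by simpa only [Prod.mk_zero_zero, add_zero] using h)).filter_mono nhdsWithin_le_nhds
  obtain ⟨ε, hε, hεpos : 0 < ε⟩ := (hnear.and self_mem_nhdsWithin).exists
  obtain ⟨η, hη⟩ := exists_boost_fst_eq (v := v + (ε, 0))
    (by simpa using hv.trans_lt (lt_add_of_pos_right _ hεpos))
  refine ⟨η, lt_of_le_of_lt (mul_le_mul_of_nonneg_left ?_ hD) (hη ▸ hε)⟩
  rw [map_add, Prod.fst_add, boost_apply η (ε, 0), mul_zero, add_zero]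
  exact le_add_of_nonneg_right (mul_nonneg (Real.cosh_pos η).le hεpos.le)

theorem blochValue_testMatrix_normalized {z : ℝ} (hz : |z| < 1) {e : ℂ} (he : ‖e‖ = 1) (α β : ℝ)
    (w : ℂ) :
    blochValue (testMatrix ![((√(1 + z))⁻¹ : ℝ), (√(1 - z))⁻¹ * e] α β) z (√(1 - z ^ 2) * w) =
      α - β * (w * e).re := by
  obtain ⟨hneg, hpos⟩ := abs_lt.1 hz
  have hplus : 0 < 1 + z := by linarith
  have hminus : 0 < 1 - z := by linarith
  have hsqrt : √(1 - z ^ 2) = √(1 + z) * √(1 - z) := by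
    rw [← Real.sqrt_mul hplus.le]
    ring_nf
  have hplus_sqrt : √(1 + z) ≠ 0 := (Real.sqrt_pos.2 hplus).ne'
  have hminus_sqrt : √(1 - z) ≠ 0 := (Real.sqrt_pos.2 hminus).ne'
  have hprod : (√(1 - z ^ 2) : ℂ) * w * (star (((√(1 + z))⁻¹ : ℝ) : ℂ) * ((√(1 - z))⁻¹ * e)) =
      w * e := by
    rw [hsqrt, Complex.star_def, Complex.conj_ofReal]
    push_cast
    field_simp [hplus_sqrt, hminus_sqrt]
  have hnorm : (1 + z) / 2 * Complex.normSq ((√(1 + z))⁻¹ : ℝ) +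
      (1 - z) / 2 * Complex.normSq ((√(1 - z))⁻¹ * e) = 1 := by
    rw [map_mul, Complex.normSq_eq_norm_sq e, he, Complex.normSq_ofReal,
      Complex.normSq_ofReal, ← mul_inv, ← mul_inv, Real.mul_self_sqrt hplus.le,
      Real.mul_self_sqrt hminus.le]
    field_simp
    ring
  rw [blochValue_testMatrix, Matrix.cons_val_zero, Matrix.cons_val_one, Matrix.cons_val_fin_one,
    hnorm, hprod, one_mul]

theorem BlochPrecedes.cot_le {d₁ d₂ z η θ₀ θ₁ : ℝ} {p q : Minkowski} {w w' e : ℂ}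
    (h : BlochPrecedes d₁ d₂ p z (√(1 - z ^ 2) * w) q z (√(1 - z ^ 2) * w')) (hz : |z| < 1)
    (he : ‖e‖ = 1) (hθ : θ₀ = θ₁ + |d₁ - d₂| * (boost η (q - p)).1) (hθ₁ : 0 < θ₁)
    (hθ₀ : θ₀ < Real.pi) :
    (Real.cos θ₀ - (w * e).re) / Real.sin θ₀ ≤ (Real.cos θ₁ - (w' * e).re) / Real.sin θ₁ := by
  set D := |d₁ - d₂|
  let τ : Minkowski →L[ℝ] ℝ := .fst ℝ ℝ ℝ ∘L boost η
  have hτ_plus : 0 ≤ τ (1, 1) := by simp [τ, boost_one_one, Real.exp_nonneg]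
  have hτ_minus : 0 ≤ τ (1, -1) := by simp [τ, boost_one_neg_one, Real.exp_nonneg]
  have hθτ : θ₀ = θ₁ + D * (τ q - τ p) := by rw [hθ, ← map_sub]; rfl
  refine le_of_forall_pos_le_add fun δ hδ => ?_
  obtain ⟨b, G, ε, hε, hb, hbc, hG, hGc, hGb, hbp, hbq, hGle⟩ := exists_profile
    (D := D) (t₀ := τ p) (t₁ := τ q) (β := θ₁ + D * τ q) (abs_nonneg _)
    (h.map_le hτ_plus hτ_minus) (by linarith) (by linarith) hδ
  rw [show θ₁ + D * τ q - D * τ p = θ₀ by linarith] at hbp hGle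
  rw [add_sub_cancel_right] at hbq hGle
  obtain ⟨χ, hχ, hχc, hχ01, hχε, hχ1⟩ :=
    exists_slow_cutoff hε (max |(boost η p).2| |(boost η q).2|)
  have hGmono : Monotone G := monotone_of_deriv_nonneg (hG.differentiable (by simp)) fun t =>
    le_trans (by positivity) (hGb t)
  have hpair := (isCausalPair_of_profile (δ := d₁ - d₂) (hb.differentiable (by simp))
    (hG.differentiable (by simp)) (hχ.differentiable (by simp))
    (by simpa only [D, sq_abs] using hGb) hχ01 hχε).comp_boost η
  have hBc : HasCompactSupport fun y : Minkowski => b y.1 * χ y.2 :=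
    .intro (hbc.isCompact.prod hχc.isCompact) fun y hy => by_contra fun hne =>
      hy ⟨subset_tsupport _ (left_ne_zero_of_mul hne), subset_tsupport _ (right_ne_zero_of_mul hne)⟩
  have hle := h.testMatrix_le hpair (comp_linear_mem_scalarAlgebra hG hGc hGmono hτ_plus hτ_minus)
    (((hb.comp contDiff_fst).mul (hχ.comp contDiff_snd)).comp (boost η).contDiff)
    (hBc.comp_homeomorph (boost η).toHomeomorph) ![((√(1 + z))⁻¹ : ℝ), (√(1 - z))⁻¹ * e]
  rw [blochValue_testMatrix_normalized hz he, blochValue_testMatrix_normalized hz he] at hle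
  simp only [Function.comp_apply, hχ1 _ (le_max_left _ _), hχ1 _ (le_max_right _ _), mul_one] at hle
  change G (τ p) - b (τ p) * _ ≤ G (τ q) - b (τ q) * _ at hle
  rw [hbp, hbq] at hle
  rw [sub_div, sub_div, div_eq_inv_mul (w * e).re, div_eq_inv_mul (w' * e).re]
  linarith

theorem BlochPrecedes.arccos_le {d₁ d₂ z : ℝ} {p q : Minkowski} {w w' e : ℂ}
    (h : BlochPrecedes d₁ d₂ p z (√(1 - z ^ 2) * w) q z (√(1 - z ^ 2) * w')) (hz : |z| < 1)
    (he : ‖e‖ = 1) :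
    Real.arccos (w * e).re ≤
      Real.arccos (w' * e).re + |d₁ - d₂| * √(-metric (q - p) (q - p)) := by
  by_contra! hlt
  obtain ⟨η, hη⟩ := exists_boost_mul_fst_lt (abs_nonneg (d₁ - d₂)) h.abs_snd_le
    (lt_sub_iff_add_lt'.2 hlt)
  obtain ⟨θ₁, hθ₁, hθ₁'⟩ := exists_between (lt_sub_comm.1 hη)
  set θ₀ := θ₁ + |d₁ - d₂| * (boost η (q - p)).1 with hθ₀
  have hboost : 0 ≤ (boost η (q - p)).1 := by
    rw [map_sub, Prod.fst_sub, sub_nonneg]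
    exact h.map_le (ℓ := .fst ℝ ℝ ℝ ∘L boost η) (by simp [boost_one_one, Real.exp_nonneg])
      (by simp [boost_one_neg_one, Real.exp_nonneg])
  have hθ₁_pos : 0 < θ₁ := (Real.arccos_nonneg _).trans_lt hθ₁
  have hθ : θ₁ ≤ θ₀ := le_add_of_nonneg_right (mul_nonneg (abs_nonneg _) hboost)
  have hθ₀_lt : θ₀ < Real.arccos (w * e).re := lt_sub_iff_add_lt.1 hθ₁'
  have hθ₀_pi : θ₀ < Real.pi := hθ₀_lt.trans_le (Real.arccos_le_pi _)
  have hcos₀ : (w * e).re < Real.cos θ₀ := by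
    by_contra! hle
    have := Real.antitone_arccos hle
    rw [Real.arccos_cos (hθ₁_pos.le.trans hθ) hθ₀_pi.le] at this
    exact this.not_gt hθ₀_lt
  have hcos₁ : Real.cos θ₁ < (w' * e).re := by
    by_contra! hle
    have := Real.antitone_arccos hle
    rw [Real.arccos_cos hθ₁_pos.le (hθ.trans hθ₀_pi.le)] at this
    exact this.not_gt hθ₁
  have hsin₀ : 0 < Real.sin θ₀ := Real.sin_pos_of_pos_of_lt_pi (hθ₁_pos.trans_le hθ) hθ₀_pi
  have hsin₁ : 0 < Real.sin θ₁ := Real.sin_pos_of_pos_of_lt_pi hθ₁_pos (hθ.trans_lt hθ₀_pi)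
  exact absurd (h.cot_le hz he hθ₀ hθ₁_pos hθ₀_pi) (not_le.2
    ((div_neg_of_neg_of_pos (sub_neg.2 hcos₁) hsin₁).trans (div_pos (sub_pos.2 hcos₀) hsin₀)))

theorem BlochPrecedes.abs_arccos_sub_le {d₁ d₂ z : ℝ} {p q : Minkowski} {w w' e : ℂ}
    (h : BlochPrecedes d₁ d₂ p z (√(1 - z ^ 2) * w) q z (√(1 - z ^ 2) * w')) (hz : |z| < 1)
    (he : ‖e‖ = 1) :
    |Real.arccos (w' * e).re - Real.arccos (w * e).re| ≤
      √(-metric (q - p) (q - p)) * |d₁ - d₂| := by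
  have hle := h.arccos_le hz he
  have hneg := h.arccos_le hz ((norm_neg e).trans he)
  simp only [mul_neg, Complex.neg_re, Real.arccos_neg] at hneg
  rw [abs_le]
  constructor <;> linarith

/-! ### The causal relation between product states -/

/-- The third coordinate of the Bloch vector of a density matrix. -/
def blochHeight (ρ : DensityMatrix) : ℝ := 2 * (ρ.1 0 0).re - 1

/-- The first two coordinates of the Bloch vector of a density matrix, as a complex number. -/
def blochEquator (ρ : DensityMatrix) : ℂ := 2 * ρ.1 1 0

theorem densityMatrix_eq (ρ : DensityMatrix) :
    ρ.1 = !![((1 + blochHeight ρ) / 2 : ℂ), star (blochEquator ρ) / 2;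
      blochEquator ρ / 2, (1 - blochHeight ρ) / 2] := by
  have hherm : ρ.1.IsHermitian := ρ.2.1.1
  have hdiag : (((ρ.1 0 0).re : ℝ) : ℂ) = ρ.1 0 0 := hherm.coe_re_apply_self 0
  have htr : ρ.1 0 0 + ρ.1 1 1 = 1 := by rw [← Matrix.trace_fin_two, ρ.2.2]
  rw [Matrix.eta_fin_two ρ.1, ← hherm.apply 0 1, eq_sub_of_add_eq' htr]
  simp [blochHeight, blochEquator, hdiag]
  ring

theorem densityMatrix_ext {ρ σ : DensityMatrix} (hheight : blochHeight ρ = blochHeight σ)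
    (hequator : blochEquator ρ = blochEquator σ) : ρ = σ :=
  Subtype.ext (by rw [densityMatrix_eq ρ, densityMatrix_eq σ, hheight, hequator])

theorem blochHeight_of_eq_blochMatrix {ρ : DensityMatrix} {r : EuclideanSpace ℝ (Fin 3)}
    (hρ : ρ.1 = blochMatrix r) : blochHeight ρ = r 2 := by
  simp [blochHeight, hρ, blochMatrix]

theorem blochEquator_of_eq_blochMatrix {ρ : DensityMatrix} {r : EuclideanSpace ℝ (Fin 3)}
    (hρ : ρ.1 = blochMatrix r) : blochEquator ρ = r 0 + r 1 * Complex.I := by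
  simp [blochEquator, hρ, blochMatrix]

theorem det_densityMatrix (ρ : DensityMatrix) :
    ρ.1.det = ((1 - blochHeight ρ ^ 2 - ‖blochEquator ρ‖ ^ 2) / 4 : ℝ) := by
  have hnorm := Complex.mul_conj' (blochEquator ρ)
  rw [densityMatrix_eq ρ, Matrix.det_fin_two_of, Complex.star_def]
  push_cast
  linear_combination (-1 / 4 : ℂ) * hnorm

theorem norm_blochEquator_sq_le (ρ : DensityMatrix) :
    ‖blochEquator ρ‖ ^ 2 ≤ 1 - blochHeight ρ ^ 2 := by
  have hdet := ρ.2.1.det_nonneg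
  rw [det_densityMatrix, Complex.zero_le_real] at hdet
  linarith

theorem IsPure.norm_blochEquator_sq {ρ : DensityMatrix} (hρ : IsPure ρ) :
    ‖blochEquator ρ‖ ^ 2 = 1 - blochHeight ρ ^ 2 := by
  obtain ⟨ξ, hξ⟩ := hρ
  have hdet := det_densityMatrix ρ
  rw [hξ, Matrix.det_vecMulVec, ← Complex.ofReal_zero, Complex.ofReal_inj] at hdet
  linarith

theorem abs_blochHeight_le_one (ρ : DensityMatrix) : |blochHeight ρ| ≤ 1 := by
  rw [← sq_le_one_iff_abs_le_one]
  linarith [norm_blochEquator_sq_le ρ, sq_nonneg ‖blochEquator ρ‖]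

theorem productState_re (p : Minkowski) (ρ : DensityMatrix) {a : algebra}
    (ha : (a.1 p).IsHermitian) :
    ((productState p ρ).toFun a).re = blochValue (a.1 p) (blochHeight ρ) (blochEquator ρ) := by
  change ((ρ.1 * a.1 p).trace).re = _
  simp only [Matrix.trace_fin_two, Matrix.mul_apply, Fin.sum_univ_two]
  rw [densityMatrix_eq ρ]
  simp [isHermitian_apply_one_zero ha, blochValue]
  ring

theorem precedes_iff_blochPrecedes {d₁ d₂ : ℝ} {p q : Minkowski} {ρ σ : DensityMatrix} :
    (productState p ρ).Precedes d₁ d₂ (productState q σ) ↔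
      BlochPrecedes d₁ d₂ p (blochHeight ρ) (blochEquator ρ) q (blochHeight σ)
        (blochEquator σ) :=
  forall₂_congr fun a ha => by
    rw [productState_re p ρ (ha.1 p), productState_re q σ (ha.1 q)]

theorem exists_straight_causalCurve {p q : Minkowski} (h : |(q - p).2| ≤ (q - p).1) :
    ∃ (γ : ℝ → Minkowski) (T : ℝ), IsCausalCurve γ T ∧ γ 0 = p ∧ γ T = q ∧
      properTime γ T = √(-metric (q - p) (q - p)) := by
  rcases ((abs_nonneg _).trans h).eq_or_lt with htime | htime
  · have hspace : (q - p).2 = 0 := abs_nonpos_iff.1 (htime ▸ h)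
    have hpq : q - p = 0 := Prod.ext htime.symm hspace
    refine ⟨fun _ => p, 0, ⟨le_rfl, contDiffOn_const, fun h => absurd h (lt_irrefl 0)⟩, rfl,
      (sub_eq_zero.1 hpq).symm, ?_⟩
    simp [hpq, properTime, metric]
  have hvelocity : ∀ t ∈ Set.Icc (0 : ℝ) 1, velocity (fun t => p + t • (q - p)) 1 t = q - p := by
    intro t ht
    have hline : HasDerivAt (fun t : ℝ => p + t • (q - p)) (q - p) t := by
      simpa using ((hasDerivAt_id t).smul_const (q - p)).const_add p
    exact hline.hasDerivWithinAt.derivWithin (uniqueDiffOn_Icc zero_lt_one t ht)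
  have hcausal : IsFutureCausal (q - p) := by
    refine ⟨?_, htime⟩
    rw [metric]
    linarith [sq_le_sq' (abs_le.1 h).1 (abs_le.1 h).2]
  refine ⟨fun t => p + t • (q - p), 1, ⟨zero_le_one, ?_, fun _ t ht => ?_⟩, by simp,
    by simp, ?_⟩
  · exact (contDiff_const.add (contDiff_id.smul contDiff_const)).contDiffOn
  · rwa [hvelocity t ht]
  · calc properTime (fun t => p + t • (q - p)) 1
        = ∫ _ in (0 : ℝ)..1, √(-metric (q - p) (q - p)) :=
          intervalIntegral.integral_congr fun t ht => by
            rw [Set.uIcc_of_le zero_le_one] at ht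
            simp only [hvelocity t ht]
      _ = √(-metric (q - p) (q - p)) := by simp

theorem bddAbove_arccos_sub (f g : ℝ → ℝ) :
    BddAbove (Set.range fun θ => |Real.arccos (f θ) - Real.arccos (g θ)|) := by
  refine ⟨Real.pi, Set.forall_mem_range.2 fun θ => ?_⟩
  exact (abs_sub_le_of_nonneg_of_le (Real.arccos_nonneg _) (Real.arccos_le_pi _)
    (Real.arccos_nonneg _) (Real.arccos_le_pi _))

theorem re_polar_mul_exp (r ϑ θ : ℝ) :
    (r * Complex.exp (ϑ * Complex.I) * Complex.exp (θ * Complex.I)).re =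
      r * Real.cos (ϑ + θ) := by
  rw [mul_assoc, ← Complex.exp_add, ← add_mul, ← Complex.ofReal_add, Complex.re_ofReal_mul,
    Complex.exp_ofReal_mul_I_re]

theorem norm_ofReal_mul_exp {r : ℝ} (hr : 0 ≤ r) (θ : ℝ) :
    ‖(r * Complex.exp (θ * Complex.I) : ℂ)‖ = r := by
  rw [norm_mul, Complex.norm_exp_ofReal_mul_I, mul_one, Complex.norm_of_nonneg hr]

theorem norm_div_mul_exp_le_one {r N : ℝ} (hr : 0 ≤ r) (hrN : r ≤ N) (θ : ℝ) :
    ‖((r / N : ℝ) * Complex.exp (θ * Complex.I) : ℂ)‖ ≤ 1 := by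
  rw [norm_ofReal_mul_exp (div_nonneg hr (hr.trans hrN))]
  exact div_le_one_of_le₀ hrN (hr.trans hrN)

theorem mul_div_mul_exp {r N : ℝ} (hr : 0 ≤ r) (hrN : r ≤ N) (θ : ℝ) :
    (N * ((r / N : ℝ) * Complex.exp (θ * Complex.I)) : ℂ) = r * Complex.exp (θ * Complex.I) := by
  have hcancel : N * (r / N) = r := mul_div_cancel_of_imp' fun hN => le_antisymm (hN ▸ hrN) hr
  rw [← mul_assoc, ← Complex.ofReal_mul, hcancel]

theorem add_mul_I_eq_mul_exp {x y r θ : ℝ} (hx : x = r * Real.cos θ) (hy : y = r * Real.sin θ) :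
    (x + y * Complex.I : ℂ) = r * Complex.exp (θ * Complex.I) := by
  rw [hx, hy, Complex.exp_mul_I]
  push_cast
  ring

theorem BlochPrecedes.iSup_le {d₁ d₂ : ℝ} {p q : Minkowski} {z r θr s θs : ℝ}
    (hz : |z| ≤ 1) (hr : 0 ≤ r) (hrz : r ≤ √(1 - z ^ 2)) (hs : 0 ≤ s) (hsz : s ≤ √(1 - z ^ 2))
    (h : BlochPrecedes d₁ d₂ p z (r * Complex.exp (θr * Complex.I)) q z
      (s * Complex.exp (θs * Complex.I))) :
    ⨆ θ : ℝ, |Real.arccos (s / √(1 - z ^ 2) * Real.cos (θs + θ)) -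
      Real.arccos (r / √(1 - z ^ 2) * Real.cos (θr + θ))| ≤
      √(-metric (q - p) (q - p)) * |d₁ - d₂| := by
  refine ciSup_le fun θ => ?_
  rcases hz.eq_or_lt with hpole | hz
  · rw [← sq_abs z, hpole]
    simp only [one_pow, sub_self, Real.sqrt_zero, div_zero, zero_mul, Real.arccos_zero, abs_zero]
    positivity
  · rw [← mul_div_mul_exp hr hrz, ← mul_div_mul_exp hs hsz] at h
    simpa only [re_polar_mul_exp] using h.abs_arccos_sub_le hz (Complex.norm_exp_ofReal_mul_I θ)

theorem blochPrecedes_of_iSup_le {d₁ d₂ : ℝ} {γ : ℝ → Minkowski} {T z r θr s θs : ℝ}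
    (hγ : IsCausalCurve γ T) (hz : |z| ≤ 1) (hr : 0 ≤ r) (hrz : r ≤ √(1 - z ^ 2)) (hs : 0 ≤ s)
    (hsz : s ≤ √(1 - z ^ 2))
    (h : ⨆ θ : ℝ, |Real.arccos (s / √(1 - z ^ 2) * Real.cos (θs + θ)) -
      Real.arccos (r / √(1 - z ^ 2) * Real.cos (θr + θ))| ≤ properTime γ T * |d₁ - d₂|) :
    BlochPrecedes d₁ d₂ (γ 0) z (r * Complex.exp (θr * Complex.I)) (γ T) z
      (s * Complex.exp (θs * Complex.I)) := by
  intro a ha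
  rw [← mul_div_mul_exp hr hrz, ← mul_div_mul_exp hs hsz]
  refine blochValue_le_of_arccos ha hγ hz (norm_div_mul_exp_le_one hr hrz _)
    (norm_div_mul_exp_le_one hs hsz _) fun θ => ?_
  simp only [re_polar_mul_exp]
  exact (le_ciSup (bddAbove_arccos_sub (fun θ => s / √(1 - z ^ 2) * Real.cos (θs + θ))
    fun θ => r / √(1 - z ^ 2) * Real.cos (θr + θ)) θ).trans h

theorem precedes_iff_exists_causalCurve {d₁ d₂ : ℝ} {p q : Minkowski} {ρ σ : DensityMatrix}
    {r θr s θs : ℝ} (hr : 0 ≤ r) (hρ : blochEquator ρ = r * Complex.exp (θr * Complex.I))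
    (hs : 0 ≤ s) (hσ : blochEquator σ = s * Complex.exp (θs * Complex.I)) :
    (productState p ρ).Precedes d₁ d₂ (productState q σ) ↔
      Precedes p q ∧ blochHeight ρ = blochHeight σ ∧
      ∃ (γ : ℝ → Minkowski) (T : ℝ), IsCausalCurve γ T ∧ γ 0 = p ∧ γ T = q ∧
        properTime γ T * |d₁ - d₂| ≥
          ⨆ θ : ℝ, |Real.arccos (s / √(1 - blochHeight ρ ^ 2) * Real.cos (θs + θ)) -
            Real.arccos (r / √(1 - blochHeight ρ ^ 2) * Real.cos (θr + θ))| := by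
  have hz := abs_blochHeight_le_one ρ
  have hr_le : r ≤ √(1 - blochHeight ρ ^ 2) := Real.le_sqrt_of_sq_le <| by
    simpa only [hρ, norm_ofReal_mul_exp hr] using norm_blochEquator_sq_le ρ
  have hs_le : s ≤ √(1 - blochHeight σ ^ 2) := Real.le_sqrt_of_sq_le <| by
    simpa only [hσ, norm_ofReal_mul_exp hs] using norm_blochEquator_sq_le σ
  rw [precedes_iff_blochPrecedes, hρ, hσ]
  constructor
  · intro h
    obtain ⟨γ, T, hγ, hγ0, hγT, hl⟩ := exists_straight_causalCurve h.abs_snd_le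
    have hheight := h.eq
    rw [← hheight] at h hs_le
    exact ⟨⟨γ, T, hγ, hγ0, hγT⟩, hheight, γ, T, hγ, hγ0, hγT,
      hl ▸ h.iSup_le hz hr hr_le hs hs_le⟩
  · rintro ⟨-, hheight, γ, T, hγ, rfl, rfl, hsup⟩
    rw [← hheight] at hs_le ⊢
    exact blochPrecedes_of_iSup_le hγ hz hr hr_le hs hs_le hsup

/-! ### Causal paths of mixed states -/

theorem pureVector_dotProduct_star {z : ℝ} (hz : |z| ≤ 1) (θ : ℝ) :
    pureVector z θ ⬝ᵥ star (pureVector z θ) = 1 := by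
  have hplus : (√((1 + z) / 2) : ℂ) * √((1 + z) / 2) = (1 + z) / 2 :=
    mod_cast Real.mul_self_sqrt (by linarith [(abs_le.1 hz).1])
  have hminus : (√((1 - z) / 2) : ℂ) * √((1 - z) / 2) = (1 - z) / 2 :=
    mod_cast Real.mul_self_sqrt (by linarith [(abs_le.1 hz).2])
  simp only [dotProduct, Fin.sum_univ_two, pureVector, Matrix.cons_val_zero, Matrix.cons_val_one,
    Pi.star_apply, Complex.star_def, map_mul, Complex.conj_ofReal]
  linear_combination hplus + hminus +
    √((1 - z) / 2) * √((1 - z) / 2) * conj_exp_ofReal_mul_I θ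

/-- The pure state whose Bloch vector has height `z` and azimuth `θ`. -/
def pureDensity (z : ℝ) (hz : |z| ≤ 1) (θ : ℝ) : DensityMatrix :=
  ⟨Matrix.vecMulVec (pureVector z θ) (star (pureVector z θ)),
    Matrix.posSemidef_vecMulVec_self_star _,
    (Matrix.trace_vecMulVec _ _).trans (pureVector_dotProduct_star hz θ)⟩

theorem isPure_pureDensity (z : ℝ) (hz : |z| ≤ 1) (θ : ℝ) : IsPure (pureDensity z hz θ) :=
  ⟨_, rfl⟩

theorem blochHeight_pureDensity (z : ℝ) (hz : |z| ≤ 1) (θ : ℝ) :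
    blochHeight (pureDensity z hz θ) = z := by
  change 2 * (√((1 + z) / 2) * star (√((1 + z) / 2) : ℂ)).re - 1 = z
  rw [Complex.star_def, Complex.conj_ofReal, ← Complex.ofReal_mul, Complex.ofReal_re,
    Real.mul_self_sqrt (by linarith [(abs_le.1 hz).1])]
  ring

theorem blochEquator_pureDensity (z : ℝ) (hz : |z| ≤ 1) (θ : ℝ) :
    blochEquator (pureDensity z hz θ) = √(1 - z ^ 2) * Complex.exp (θ * Complex.I) := by
  change 2 * (√((1 - z) / 2) * Complex.exp (θ * Complex.I) * star (√((1 + z) / 2) : ℂ)) = _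
  rw [sqrt_one_sub_sq hz, Complex.star_def, Complex.conj_ofReal]
  push_cast
  ring

theorem continuous_pureDensity (z : ℝ) (hz : |z| ≤ 1) : Continuous (pureDensity z hz) := by
  have hvector : Continuous (pureVector z) := by
    refine continuous_pi fun i => ?_
    fin_cases i <;> simp only [pureVector] <;> fun_prop
  exact Continuous.subtype_mk (hvector.matrix_vecMulVec hvector.star) _

theorem continuous_blochEquator : Continuous blochEquator :=
  continuous_const.mul (continuous_subtype_val.matrix_elem 1 0)

theorem IsPure.exists_phase {ρ : DensityMatrix} (hρ : IsPure ρ) :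
    ∃ α : ℝ, blochEquator ρ = √(1 - blochHeight ρ ^ 2) * Complex.exp (α * Complex.I) := by
  refine ⟨Complex.arg (blochEquator ρ), ?_⟩
  rw [← hρ.norm_blochEquator_sq, Real.sqrt_sq (norm_nonneg _), Complex.norm_mul_exp_arg_mul_I]

theorem exists_abs_eq_arccos_cos (x : ℝ) :
    ∃ y : ℝ, |y| = Real.arccos (Real.cos x) ∧
      Complex.exp (y * Complex.I) = Complex.exp (x * Complex.I) := by
  have hexp : Complex.exp (Complex.arg (Complex.exp (x * Complex.I)) * Complex.I) =
      Complex.exp (x * Complex.I) := by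
    simpa using Complex.norm_mul_exp_arg_mul_I (Complex.exp (x * Complex.I))
  refine ⟨Complex.arg (Complex.exp (x * Complex.I)), ?_, hexp⟩
  rw [← Complex.exp_ofReal_mul_I_re x, ← hexp, Complex.exp_ofReal_mul_I_re, hexp, ← Real.cos_abs,
    Real.arccos_cos (abs_nonneg _) (Complex.abs_arg_le_pi _)]

theorem continuousOn_elapsed {γ : ℝ → Minkowski} {T : ℝ} (hγ : IsCausalCurve γ T) :
    ContinuousOn (elapsed γ T) (Set.Icc 0 T) := by
  rcases hγ.1.eq_or_lt with rfl | hT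
  · rw [Set.Icc_self]
    exact continuousOn_singleton _ _
  · exact fun t ht => (hasDerivWithinAt_elapsed hγ hT ht).continuousWithinAt

theorem metric_smul_self (r : ℝ) (v : Minkowski) :
    metric (r • v) (r • v) = r ^ 2 * metric v v := by
  simp only [metric, Prod.smul_fst, Prod.smul_snd, smul_eq_mul]
  ring

theorem slope_lt_of_metric_bound {γ : ℝ → Minkowski} {f : ℝ → ℝ} {D R t u : ℝ} (htu : t < u)
    (h : f u - f t ≤ √(-metric (γ u - γ t) (γ u - γ t)) * D)
    (hR : √(-metric (slope γ t u) (slope γ t u)) * D < R) : slope f t u < R := by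
  have hinv : 0 < (u - t)⁻¹ := inv_pos.2 (sub_pos.2 htu)
  rw [slope, vsub_eq_sub, metric_smul_self, ← mul_neg, Real.sqrt_mul (sq_nonneg _),
    Real.sqrt_sq hinv.le, mul_assoc] at hR
  rw [slope, vsub_eq_sub, smul_eq_mul]
  exact (mul_le_mul_of_nonneg_left h hinv.le).trans_lt hR

theorem sub_le_properTime_mul {γ : ℝ → Minkowski} {T D : ℝ} (hγ : IsCausalCurve γ T)
    {f : ℝ → ℝ} (hf : ContinuousOn f (Set.Icc 0 T))
    (h : ∀ t ∈ Set.Icc 0 T, ∀ t' ∈ Set.Icc 0 T, t ≤ t' →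
      f t' - f t ≤ √(-metric (γ t' - γ t) (γ t' - γ t)) * D) :
    f T - f 0 ≤ properTime γ T * D := by
  rcases hγ.1.eq_or_lt with rfl | hT
  · simp [properTime]
  refine sub_le_iff_le_add'.2 (image_le_of_liminf_slope_right_le_deriv_boundary
    (B := fun t => f 0 + elapsed γ T t * D)
    (B' := fun t => √(-metric (velocity γ T t) (velocity γ T t)) * D) hf (by simp [elapsed_zero])
    (((continuousOn_elapsed hγ).mul_const D).const_add (f 0)) (fun t ht => ?_)
    (fun t ht R hR => ?_) (Set.right_mem_Icc.2 hT.le))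
  · exact ((hasDerivWithinAt_elapsed hγ hT ⟨ht.1, ht.2.le⟩).mul_const D).const_add (f 0)
      |>.mono_of_mem_nhdsWithin (Icc_mem_nhdsGE_of_mem ht)
  · have hslope : Filter.Tendsto (slope γ t) (𝓝[>] t) (𝓝 (velocity γ T t)) :=
      (hasDerivWithinAt_iff_tendsto_slope' (lt_irrefl t)).1
        ((hasDerivWithinAt_causalCurve hγ ⟨ht.1, ht.2.le⟩).mono_of_mem_nhdsWithin
          (Icc_mem_nhdsGT_of_mem ht))
    have hcont : Continuous fun v : Minkowski => √(-metric v v) * D := by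
      unfold metric
      fun_prop
    have hspeed := (hcont.tendsto (velocity γ T t)).comp hslope |>.eventually_lt_const hR
    refine Filter.Eventually.frequently ?_
    filter_upwards [hspeed, Icc_mem_nhdsGT_of_mem ht, self_mem_nhdsWithin] with u hu hmem htu
    exact slope_lt_of_metric_bound htu (h t ⟨ht.1, ht.2.le⟩ u hmem (le_of_lt htu)) hu

section IsCausalPath

variable {d₁ d₂ : ℝ} {γ : ℝ → Minkowski} {T : ℝ} {ρ : ℝ → DensityMatrix}

theorem IsCausalPath.blochPrecedes (h : IsCausalPath d₁ d₂ γ T ρ) {t t' : ℝ}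
    (ht : t ∈ Set.Icc 0 T) (ht' : t' ∈ Set.Icc 0 T) (htt' : t ≤ t') :
    BlochPrecedes d₁ d₂ (γ t) (blochHeight (ρ t)) (blochEquator (ρ t)) (γ t')
      (blochHeight (ρ t')) (blochEquator (ρ t')) :=
  precedes_iff_blochPrecedes.1 (h.2.2 t ht t' ht' htt')

theorem IsCausalPath.blochHeight_eq (h : IsCausalPath d₁ d₂ γ T ρ) {t : ℝ}
    (ht : t ∈ Set.Icc 0 T) : blochHeight (ρ t) = blochHeight (ρ 0) :=
  (h.blochPrecedes ⟨le_rfl, ht.1.trans ht.2⟩ ht ht.1).eq.symm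

theorem IsCausalPath.arccos_cos_sub_le (h : IsCausalPath d₁ d₂ γ T ρ) {z : ℝ} (hz : |z| < 1)
    (hheight : ∀ t ∈ Set.Icc 0 T, blochHeight (ρ t) = z) {α α' : ℝ}
    (h0 : blochEquator (ρ 0) = √(1 - z ^ 2) * Complex.exp (α * Complex.I))
    (hT : blochEquator (ρ T) = √(1 - z ^ 2) * Complex.exp (α' * Complex.I)) :
    Real.arccos (Real.cos (α' - α)) ≤ properTime γ T * |d₁ - d₂| := by
  have hN : (√(1 - z ^ 2) : ℂ) ≠ 0 := Complex.ofReal_ne_zero.2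
    (Real.sqrt_pos.2 (sub_pos.2 ((sq_lt_one_iff_abs_lt_one z).2 hz))).ne'
  set w : ℝ → ℂ := fun t => blochEquator (ρ t) / √(1 - z ^ 2)
  have hequator (t : ℝ) : blochEquator (ρ t) = √(1 - z ^ 2) * w t :=
    (mul_div_cancel₀ _ hN).symm
  have hcont : ContinuousOn (fun t => Real.arccos
      (w t * Complex.exp ((-α : ℝ) * Complex.I)).re) (Set.Icc 0 T) :=
    (Real.continuous_arccos.comp (Complex.continuous_re.comp
      ((continuous_blochEquator.div_const _).mul_const _))).comp_continuousOn h.2.1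
  have hmain := sub_le_properTime_mul h.1 (D := |d₁ - d₂|) hcont fun t ht t' ht' htt' => by
    have hprec := h.blochPrecedes ht ht' htt'
    rw [hheight t ht, hheight t' ht', hequator, hequator] at hprec
    exact (le_abs_self _).trans
      (hprec.abs_arccos_sub_le hz (Complex.norm_exp_ofReal_mul_I _))
  have hphase {t ϑ : ℝ} (ht : blochEquator (ρ t) = √(1 - z ^ 2) * Complex.exp (ϑ * Complex.I)) :
      (w t * Complex.exp ((-α : ℝ) * Complex.I)).re = Real.cos (ϑ - α) := by
    rw [mul_left_cancel₀ hN ((hequator t).symm.trans ht), sub_eq_add_neg]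
    simpa using re_polar_mul_exp 1 ϑ (-α)
  simp only [hphase h0, hphase hT, sub_self, Real.cos_zero, Real.arccos_one, sub_zero] at hmain
  exact hmain

theorem IsCausalPath.exists_phase (h : IsCausalPath d₁ d₂ γ T ρ) (h0 : IsPure (ρ 0))
    (hT : IsPure (ρ T)) :
    ∃ α δ : ℝ, |δ| ≤ properTime γ T * |d₁ - d₂| ∧
      blochEquator (ρ 0) = √(1 - blochHeight (ρ 0) ^ 2) * Complex.exp (α * Complex.I) ∧
      blochEquator (ρ T) =
        √(1 - blochHeight (ρ 0) ^ 2) * Complex.exp ((α + δ : ℝ) * Complex.I) := by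
  obtain ⟨α, hα⟩ := h0.exists_phase
  obtain ⟨α', hα'⟩ := hT.exists_phase
  rw [h.blochHeight_eq (Set.right_mem_Icc.2 h.1.1)] at hα'
  rcases (abs_blochHeight_le_one (ρ 0)).eq_or_lt with hpole | hz
  · refine ⟨α, 0, ?_, hα, ?_⟩
    · rw [abs_zero]
      exact mul_nonneg (properTime_nonneg h.1.1) (abs_nonneg _)
    · rw [hα', ← sq_abs, hpole]
      simp
  · obtain ⟨δ, hδ, hexp⟩ := exists_abs_eq_arccos_cos (α' - α)
    refine ⟨α, δ, hδ ▸ h.arccos_cos_sub_le hz (fun t => h.blochHeight_eq) hα hα', hα, ?_⟩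
    rw [hα', Complex.ofReal_add, add_mul, Complex.exp_add, hexp, ← Complex.exp_add, ← add_mul,
      ← Complex.ofReal_add, add_sub_cancel]

theorem isCausalPath_pureDensity (hγ : IsCausalCurve γ T) {z : ℝ} (hz : |z| ≤ 1) (α : ℝ)
    {κ : ℝ} (hκ : |κ| ≤ |d₁ - d₂|) :
    IsCausalPath d₁ d₂ γ T fun t => pureDensity z hz (α + κ * elapsed γ T t) := by
  refine ⟨hγ, ?_, fun t ht t' ht' htt' => ?_⟩
  · exact (continuous_pureDensity z hz).comp_continuousOn
      (((continuousOn_elapsed hγ).const_mul κ).const_add α)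
  · rw [precedes_iff_blochPrecedes]
    simp only [blochHeight_pureDensity, blochEquator_pureDensity]
    exact fun a ha => monotoneOn_transport ha hγ hz α hκ ht ht' htt'

theorem exists_pure_causalPath (h : IsCausalPath d₁ d₂ γ T ρ) (h0 : IsPure (ρ 0))
    (hT : IsPure (ρ T)) :
    ∃ ρ' : ℝ → DensityMatrix, IsCausalPath d₁ d₂ γ T ρ' ∧
      (∀ t ∈ Set.Icc 0 T, IsPure (ρ' t)) ∧ ρ' 0 = ρ 0 ∧ ρ' T = ρ T := by
  obtain ⟨α, δ, hδ, hphase0, hphaseT⟩ := h.exists_phase h0 hT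
  obtain ⟨κ, hκ, rfl⟩ := exists_rate (properTime_nonneg h.1.1) hδ (abs_nonneg _)
  refine ⟨_, isCausalPath_pureDensity h.1 (abs_blochHeight_le_one (ρ 0)) α hκ,
    fun t _ => isPure_pureDensity _ _ _, densityMatrix_ext ?_ ?_, densityMatrix_ext ?_ ?_⟩
  · rw [blochHeight_pureDensity]
  · rw [blochEquator_pureDensity, elapsed_zero, mul_zero, add_zero, hphase0]
  · rw [blochHeight_pureDensity, h.blochHeight_eq (Set.right_mem_Icc.2 h.1.1)]
  · rw [blochEquator_pureDensity, hphaseT, elapsed, properTime]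

end IsCausalPath

end AlmostCommutative

end

theorem theorem3p12 (d₁ d₂ : ℝ) :
    (∀ (p q : Minkowski) (ρ σ : DensityMatrix) (r s : EuclideanSpace ℝ (Fin 3))
        (r' θr s' θs : ℝ),
      ρ.1 = blochMatrix r → σ.1 = blochMatrix s →
      0 ≤ r' → r 0 = r' * Real.cos θr → r 1 = r' * Real.sin θr →
      0 ≤ s' → s 0 = s' * Real.cos θs → s 1 = s' * Real.sin θs →
      ((productState p ρ).Precedes d₁ d₂ (productState q σ) ↔
        Precedes p q ∧ r 2 = s 2 ∧
        ∃ (γ : ℝ → Minkowski) (T : ℝ), IsCausalCurve γ T ∧ γ 0 = p ∧ γ T = q ∧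
          properTime γ T * |d₁ - d₂| ≥
            ⨆ θ : ℝ, |Real.arccos (s' / √(1 - r 2 ^ 2) * Real.cos (θs + θ)) -
              Real.arccos (r' / √(1 - r 2 ^ 2) * Real.cos (θr + θ))|)) ∧
    (∀ (γ : ℝ → Minkowski) (T : ℝ) (ρ : ℝ → DensityMatrix),
      IsCausalPath d₁ d₂ γ T ρ → IsPure (ρ 0) → IsPure (ρ T) →
      ∃ ρ' : ℝ → DensityMatrix, IsCausalPath d₁ d₂ γ T ρ' ∧
        (∀ t ∈ Set.Icc 0 T, IsPure (ρ' t)) ∧ ρ' 0 = ρ 0 ∧ ρ' T = ρ T) := by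
  refine ⟨fun p q ρ σ r s r' θr s' θs hρ hσ hr' hr0 hr1 hs' hs0 hs1 => ?_,
    fun _ _ _ => exists_pure_causalPath⟩
  have hρ_equator := (blochEquator_of_eq_blochMatrix hρ).trans (add_mul_I_eq_mul_exp hr0 hr1)
  have hσ_equator := (blochEquator_of_eq_blochMatrix hσ).trans (add_mul_I_eq_mul_exp hs0 hs1)
  rw [← blochHeight_of_eq_blochMatrix hρ, ← blochHeight_of_eq_blochMatrix hσ]
  exact precedes_iff_exists_causalCurve hr' hρ_equator hs' hσ_equator
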